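/- Let $\Bbbk$ be an algebraically closed field of characteristic $0$ and let $(\mathcal{C},\otimes,\mathbb{1})$ be a multifusion category over $\Bbbk$, i.e. a $\Bbbk$-linear abelian rigid monoidal category with $\Bbbk$-bilinear tensor product which is finite (all objects have finite length, all Hom-spaces are finite dimensional, there are enough projectives and finitely many isomorphism classes of simple objects) and semisimple (every object is a finite direct sum of simple objects). Let $A$ be an algebra in $\mathcal{C}$. Write $\mathsf{Mod}\text{-}A(\mathcal{C})$ for the category of right $A$-modules in $\mathcal{C}$, a left $\mathcal{C}$-module category via $X\otimes M$, and $A\text{-}\mathsf{Mod}(\mathcal{C})$ for the category of left $A$-modules in $\mathcal{C}$, a right $\mathcal{C}$-module category via $N\otimes X$. Assume that $\mathsf{Mod}\text{-}A(\mathcal{C})$ and $A\text{-}\mathsf{Mod}(\mathcal{C})$ satisfy the hypotheses of Ostrik's theorem, i.e. each is semisimple, non-zero, and indecomposable (not a direct sum of two non-zero module subcategories). For a right $A$-module $M$, the functor $(-\otimes M):\mathcal{C}\to\mathsf{Mod}\text{-}A(\mathcal{C})$ has a right adjoint, the internal Hom $\underline{\mathrm{Hom}}(M,-)$; the internal End $\underline{\mathrm{End}}(M)=\underline{\mathrm{Hom}}(M,M)$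 is an algebra in $\mathcal{C}$, whose product is adjoint to the composite $\underline{\mathrm{End}}(M)\otimes\underline{\mathrm{End}}(M)\otimes M\to\underline{\mathrm{End}}(M)\otimes M\to M$ of evaluations and whose unit is adjoint to $\mathbb{1}\otimes M\cong M$. Likewise, for a left $A$-module $N$, the functor $(N\otimes-):\mathcal{C}\to A\text{-}\mathsf{Mod}(\mathcal{C})$ has a right adjoint $\underline{\mathrm{Hom}}(N,-)$, and $\underline{\mathrm{End}}(N)=\underline{\mathrm{Hom}}(N,N)$ is an algebra in $\mathcal{C}$ via the evaluations $N\otimes\underline{\mathrm{End}}(N)\otimes\underline{\mathrm{End}}(N)\to N\otimes\underline{\mathrm{End}}(N)\to N$ and $N\otimes\mathbb{1}\cong N$. A non-zero algebra $E$ in $\mathcal{C}$ is called a right (resp. left) essential division algebra if the free module functor $(-\otimes E):\mathcal{C}\to\mathsf{Mod}\text{-}E(\mathcal{C})$ (resp. $(E\otimes-):\mathcal{C}\to E\text{-}\mathsf{Mod}(\mathcal{C})$) is essentially surjective. Then: (i) For every right $A$-module $M$ in $\mathcal{C}$, the algebra $\underline{\mathrm{End}}(M)$ is a right essential division algebra if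 and only if $(-\otimes M):\mathcal{C}\to\mathsf{Mod}\text{-}A(\mathcal{C})$ is essentially surjective. (ii) For every left $A$-module $N$ in $\mathcal{C}$, the algebra $\underline{\mathrm{End}}(N)$ is a left essential division algebra if and only if $(N\otimes-):\mathcal{C}\to A\text{-}\mathsf{Mod}(\mathcal{C})$ is essentially surjective. -/

import Mathlib

open CategoryTheory MonoidalCategory Limits MonObj
open scoped MonoidalLeftAction MonoidalRightAction

universe w v u v' u'

/-! ### Semisimple and multifusion categories -/

section Multifusion

/-- Every object is a finite direct sum of simple objects (the empty sum being zero). -/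
def IsSemisimpleCategory (D : Type u') [Category.{v'} D] [Preadditive D] : Prop :=
  ∀ X : D, ∃ (n : ℕ) (S : Fin n → D) (incl : ∀ i, S i ⟶ X),
    (∀ i, Simple (S i)) ∧ Nonempty (IsColimit (Cofan.mk X incl))

/-- A multifusion category over `k`: a `k`-linear abelian rigid monoidal category (with `k`-bilinear
tensor product) that is finite and semisimple. -/
structure IsMultifusion (k : Type w) [Field k] (C : Type u) [Category.{v} C] [Abelian C]
    [Linear k C] [MonoidalCategory C] [MonoidalPreadditive C] [MonoidalLinear k C]
    [RigidCategory C] : Prop where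
  /-- Every object has finite length, i.e. is Noetherian and Artinian. -/
  finite_length : ∀ X : C, IsNoetherianObject X ∧ IsArtinianObject X
  finite_hom : ∀ X Y : C, Module.Finite k (X ⟶ Y)
  enough_projectives : EnoughProjectives C
  /-- There are finitely many isomorphism classes of simple objects. -/
  finite_simples : ∃ (n : ℕ) (S : Fin n → C), ∀ X : C, Simple X → ∃ i, Nonempty (X ≅ S i)
  semisimple : IsSemisimpleCategory C

end Multifusion

/-! ### Module categories

A left (right) `C`-module category is Mathlib's `MonoidalLeftAction C D`
(`MonoidalRightAction C D`). -/

section ModuleCategories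

/-- `D` is the direct sum of its full subcategories `P` and `Q`: there are no non-zero morphisms
between them in either direction, and every object is the direct sum of an object of `P` and an
object of `Q`. -/
structure IsInternalDirectSum {D : Type u'} [Category.{v'} D] [Preadditive D]
    (P Q : ObjectProperty D) : Prop where
  hom_eq_zero : ∀ X Y : D, P X → Q Y → ∀ f : X ⟶ Y, f = 0
  hom_eq_zero' : ∀ X Y : D, P X → Q Y → ∀ f : Y ⟶ X, f = 0
  exists_decomposition : ∀ Z : D, ∃ (X Y : D) (i : X ⟶ Z) (j : Y ⟶ Z),
    P X ∧ Q Y ∧ Nonempty (IsColimit (BinaryCofan.mk i j))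

/-- The standing hypotheses of Ostrik's theorem on a left `C`-module category: it is semisimple,
non-zero, and indecomposable, i.e. it is not the direct sum of two non-zero module
subcategories. -/
structure LeftOstrikHypothesis (C : Type u) [Category.{v} C] [MonoidalCategory C]
    (D : Type u') [Category.{v'} D] [Preadditive D] [MonoidalLeftAction C D] : Prop where
  semisimple : IsSemisimpleCategory D
  nonzero : ∃ X : D, ¬ IsZero X
  indecomposable : ∀ P Q : ObjectProperty D,
    P.IsClosedUnderIsomorphisms → Q.IsClosedUnderIsomorphisms →
    (∀ (c : C) (X : D), P X → P (c ⊙ₗ X)) → (∀ (c : C) (X : D), Q X → Q (c ⊙ₗ X)) →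
    IsInternalDirectSum P Q → (∀ X, P X → IsZero X) ∨ (∀ X, Q X → IsZero X)

/-- The standing hypotheses of Ostrik's theorem on a right `C`-module category. -/
structure RightOstrikHypothesis (C : Type u) [Category.{v} C] [MonoidalCategory C]
    (D : Type u') [Category.{v'} D] [Preadditive D] [MonoidalRightAction C D] : Prop where
  semisimple : IsSemisimpleCategory D
  nonzero : ∃ X : D, ¬ IsZero X
  indecomposable : ∀ P Q : ObjectProperty D,
    P.IsClosedUnderIsomorphisms → Q.IsClosedUnderIsomorphisms →
    (∀ (X : D) (c : C), P X → P (X ⊙ᵣ c)) → (∀ (X : D) (c : C), Q X → Q (X ⊙ᵣ c)) →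
    IsInternalDirectSum P Q → (∀ X, P X → IsZero X) ∨ (∀ X, Q X → IsZero X)

end ModuleCategories

/-! ### Internal End algebras

In a left `C`-module category, the internal Hom `R = Hom(d, -)` is a right adjoint of
`(- ⊙ₗ d) : C ⥤ D`, and `R d` is an algebra: with `ev : R d ⊙ₗ d ⟶ d` the counit, the unit
corresponds to the isomorphism `𝟙 ⊙ₗ d ≅ d`, and the product to applying `ev` twice. In a right
`C`-module category one uses `(d ⊙ᵣ -)` in the same way. -/

section InternalEnd

variable {C : Type u} [Category.{v} C] [MonoidalCategory C] {D : Type u'} [Category.{v'} D]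

section Left

variable [MonoidalLeftAction C D] (d : D) {R : D ⥤ C}
  (adj : MonoidalLeftAction.actionRight C d ⊣ R)

/-- The evaluation `R d ⊙ₗ d ⟶ d`. -/
def leftEv : R.obj d ⊙ₗ d ⟶ d := adj.counit.app d

/-- The morphism `X ⟶ R d` corresponding to `f : X ⊙ₗ d ⟶ d`. -/
def leftCurry {X : C} (f : X ⊙ₗ d ⟶ d) : X ⟶ R.obj d := adj.homEquiv X d f

theorem leftCurry_ev {X : C} (f : X ⊙ₗ d ⟶ d) :
    leftCurry d adj f ⊵ₗ d ≫ leftEv d adj = f := by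
  exact (adj.homEquiv_counit (g := adj.homEquiv X d f)).symm.trans
    ((adj.homEquiv X d).symm_apply_apply f)

theorem left_hom_ext {X : C} {f g : X ⟶ R.obj d}
    (h : f ⊵ₗ d ≫ leftEv d adj = g ⊵ₗ d ≫ leftEv d adj) : f = g := by
  apply (adj.homEquiv X d).symm.injective
  rw [adj.homEquiv_counit, adj.homEquiv_counit]
  exact h

/-- The algebra structure on the internal End `R d` of an object `d` of a left module category. -/
@[reducible]
def leftInternalEnd : MonObj (R.obj d) where
  one := leftCurry d adj (λₗ d).hom
  mul := leftCurry d adj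
    ((αₗ (R.obj d) (R.obj d) d).hom ≫ R.obj d ⊴ₗ leftEv d adj ≫ leftEv d adj)
  one_mul := by
    apply left_hom_ext d adj
    rw [MonoidalLeftAction.comp_actionHomLeft, Category.assoc, leftCurry_ev,
      MonoidalLeftAction.whiskerRight_actionHomLeft]
    simp only [Category.assoc, Iso.inv_hom_id_assoc]
    rw [← MonoidalLeftAction.action_exchange_assoc, leftCurry_ev,
      ← MonoidalLeftAction.actionUnitIso_hom_naturality]
    simp
  mul_one := by
    apply left_hom_ext d adj
    rw [MonoidalLeftAction.comp_actionHomLeft, Category.assoc, leftCurry_ev,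
      MonoidalLeftAction.whiskerLeft_actionHomLeft]
    simp only [Category.assoc, Iso.inv_hom_id_assoc]
    rw [← MonoidalLeftAction.actionHomRight_comp_assoc, leftCurry_ev]
    simp
  mul_assoc := by
    apply left_hom_ext d adj
    simp only [MonoidalLeftAction.comp_actionHomLeft, Category.assoc, leftCurry_ev]
    rw [MonoidalLeftAction.whiskerRight_actionHomLeft,
      MonoidalLeftAction.whiskerLeft_actionHomLeft]
    simp only [Category.assoc, Iso.inv_hom_id_assoc]
    rw [← MonoidalLeftAction.action_exchange_assoc, leftCurry_ev,
      ← MonoidalLeftAction.actionHomRight_comp_assoc, leftCurry_ev]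
    simp only [MonoidalLeftAction.actionHomRight_comp, Category.assoc,
      MonoidalLeftAction.tensor_actionHomRight, Iso.inv_hom_id_assoc]
    rw [MonoidalLeftAction.associator_actionHom_assoc]

end Left

section Right

variable [MonoidalRightAction C D] (d : D) {R : D ⥤ C}
  (adj : MonoidalRightAction.actionLeft C d ⊣ R)

/-- The evaluation `d ⊙ᵣ R d ⟶ d`. -/
def rightEv : d ⊙ᵣ R.obj d ⟶ d := adj.counit.app d

/-- The morphism `X ⟶ R d` corresponding to `f : d ⊙ᵣ X ⟶ d`. -/
def rightCurry {X : C} (f : d ⊙ᵣ X ⟶ d) : X ⟶ R.obj d := adj.homEquiv X d f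

theorem rightCurry_ev {X : C} (f : d ⊙ᵣ X ⟶ d) :
    d ⊴ᵣ rightCurry d adj f ≫ rightEv d adj = f := by
  exact (adj.homEquiv_counit (g := adj.homEquiv X d f)).symm.trans
    ((adj.homEquiv X d).symm_apply_apply f)

theorem right_hom_ext {X : C} {f g : X ⟶ R.obj d}
    (h : d ⊴ᵣ f ≫ rightEv d adj = d ⊴ᵣ g ≫ rightEv d adj) : f = g := by
  apply (adj.homEquiv X d).symm.injective
  rw [adj.homEquiv_counit, adj.homEquiv_counit]
  exact h

/-- The algebra structure on the internal End `R d` of an object `d` of a right module category. -/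
@[reducible]
def rightInternalEnd : MonObj (R.obj d) where
  one := rightCurry d adj (ρᵣ d).hom
  mul := rightCurry d adj
    ((αᵣ d (R.obj d) (R.obj d)).hom ≫ rightEv d adj ⊵ᵣ R.obj d ≫ rightEv d adj)
  one_mul := by
    apply right_hom_ext d adj
    rw [MonoidalRightAction.actionHomRight_comp, Category.assoc, rightCurry_ev,
      MonoidalRightAction.actionHomRight_whiskerRight]
    simp only [Category.assoc, Iso.inv_hom_id_assoc]
    rw [← MonoidalRightAction.comp_actionHomLeft_assoc, rightCurry_ev]
    simp
  mul_one := by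
    apply right_hom_ext d adj
    rw [MonoidalRightAction.actionHomRight_comp, Category.assoc, rightCurry_ev,
      MonoidalRightAction.whiskerRight_actionHomLeft]
    simp only [Category.assoc, Iso.inv_hom_id_assoc]
    rw [MonoidalRightAction.action_exchange_assoc, rightCurry_ev,
      ← MonoidalRightAction.actionUnitIso_hom_naturality]
    simp
  mul_assoc := by
    apply right_hom_ext d adj
    simp only [MonoidalRightAction.actionHomRight_comp, Category.assoc, rightCurry_ev]
    rw [MonoidalRightAction.actionHomRight_whiskerRight,
      MonoidalRightAction.whiskerRight_actionHomLeft]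
    simp only [Category.assoc, Iso.inv_hom_id_assoc]
    rw [MonoidalRightAction.action_exchange_assoc, rightCurry_ev,
      ← MonoidalRightAction.comp_actionHomLeft_assoc, rightCurry_ev]
    simp only [MonoidalRightAction.comp_actionHomLeft, Category.assoc,
      MonoidalRightAction.actionHomLeft_tensor, Iso.inv_hom_id_assoc]
    rw [MonoidalRightAction.actionHom_associator_assoc]

end Right

end InternalEnd

/-! ### Right modules over an algebra

An algebra in a monoidal category is a monoid object, `MonObj A`, and the left `A`-modules in `C`
are Mathlib's `Mod C A`. Mathlib does not have the mirror image, the category of right modules. -/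

section RightModules

variable {C : Type u} [Category.{v} C] [MonoidalCategory C]

/-- A right module in `C` over the algebra `A`. -/
structure RightMod (A : C) [MonObj A] where
  /-- The underlying object. -/
  X : C
  /-- The right action of `A`. -/
  act : X ⊗ A ⟶ X
  act_one : X ◁ η[A] ≫ act = (ρ_ X).hom
  act_mul : X ◁ μ[A] ≫ act = (α_ X A A).inv ≫ act ▷ A ≫ act

namespace RightMod

variable {A : C} [MonObj A]

/-- A morphism of right modules. -/
@[ext]
structure Hom (M N : RightMod A) where
  /-- The underlying morphism. -/
  hom : M.X ⟶ N.X
  act_hom : M.act ≫ hom = hom ▷ A ≫ N.act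

instance : Category (RightMod A) where
  Hom M N := Hom M N
  id M := { hom := 𝟙 M.X, act_hom := by simp }
  comp f g :=
    { hom := f.hom ≫ g.hom
      act_hom := by
        rw [← Category.assoc, f.act_hom, Category.assoc, g.act_hom, comp_whiskerRight,
          Category.assoc] }

@[ext]
theorem hom_ext {M N : RightMod A} (f g : M ⟶ N) (h : f.hom = g.hom) : f = g := Hom.ext h

@[simp]
theorem id_hom (M : RightMod A) : Hom.hom (𝟙 M) = 𝟙 M.X := rfl

@[simp]
theorem comp_hom {M N P : RightMod A} (f : M ⟶ N) (g : N ⟶ P) :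
    (f ≫ g).hom = f.hom ≫ g.hom := rfl

/-- The regular right module `A`. -/
def regular (A : C) [MonObj A] : RightMod A where
  X := A
  act := μ[A]
  act_one := by simp
  act_mul := by simp

/-- The right module `X ⊗ M`, with `A` acting on `M`. -/
def tensor (X : C) (M : RightMod A) : RightMod A where
  X := X ⊗ M.X
  act := (α_ X M.X A).hom ≫ X ◁ M.act
  act_one := by
    simp [← whiskerLeft_comp, M.act_one]
  act_mul := by
    simp [← whiskerLeft_comp, M.act_mul]

/-- Right modules form a left `C`-module category under `tensor`. -/
instance : MonoidalLeftAction C (RightMod A) where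
  actionObj X M := tensor X M
  actionHomLeft f M :=
    { hom := f ▷ M.X
      act_hom := by simp [tensor, whisker_exchange] }
  actionHomRight X _ _ f :=
    { hom := X ◁ f.hom
      act_hom := by simp [tensor, ← whiskerLeft_comp, f.act_hom] }
  actionAssocIso X Y M :=
    { hom := { hom := (α_ X Y M.X).hom, act_hom := by simp [tensor] }
      inv := { hom := (α_ X Y M.X).inv, act_hom := by simp [tensor] }
      hom_inv_id := hom_ext _ _ (α_ X Y M.X).hom_inv_id
      inv_hom_id := hom_ext _ _ (α_ X Y M.X).inv_hom_id }
  actionUnitIso M :=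
    { hom := { hom := (λ_ M.X).hom, act_hom := by simp [tensor] }
      inv := { hom := (λ_ M.X).inv, act_hom := by simp [tensor] }
      hom_inv_id := hom_ext _ _ (λ_ M.X).hom_inv_id
      inv_hom_id := hom_ext _ _ (λ_ M.X).inv_hom_id }
  actionHomRight_id c d := hom_ext _ _ (whiskerLeft_id c d.X)
  id_actionHomLeft c d := hom_ext _ _ (id_whiskerRight c d.X)
  actionHom_comp f₁ f₂ g₁ g₂ := hom_ext _ _ (by
    change (f₁ ≫ f₂) ▷ _ ≫ _ ◁ (g₁.hom ≫ g₂.hom) =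
      (f₁ ▷ _ ≫ _ ◁ g₁.hom) ≫ f₂ ▷ _ ≫ _ ◁ g₂.hom
    simp [whisker_exchange_assoc])
  actionAssocIso_hom_naturality f g h := hom_ext _ _ (by
    change ((f ⊗ₘ g) ▷ _ ≫ _ ◁ h.hom) ≫ (α_ _ _ _).hom =
      (α_ _ _ _).hom ≫ f ▷ _ ≫ _ ◁ (g ▷ _ ≫ _ ◁ h.hom)
    simp [MonoidalCategory.tensorHom_def])
  actionUnitIso_hom_naturality f := hom_ext _ _ (leftUnitor_naturality f.hom).symm
  whiskerLeft_actionHomLeft c _ _ f d := hom_ext _ _ 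
    (MonoidalLeftAction.whiskerLeft_actionHomLeft (D := C) c f d.X)
  whiskerRight_actionHomLeft c f d := hom_ext _ _ 
    (MonoidalLeftAction.whiskerRight_actionHomLeft (D := C) c f d.X)
  associator_actionHom c₁ c₂ c₃ d := hom_ext _ _
    (MonoidalLeftAction.associator_actionHom (D := C) c₁ c₂ c₃ d.X)
  leftUnitor_actionHom c d := hom_ext _ _
    (MonoidalLeftAction.leftUnitor_actionHom (D := C) c d.X)
  rightUnitor_actionHom c d := hom_ext _ _
    (MonoidalLeftAction.rightUnitor_actionHom (D := C) c d.X)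

section Additive

variable [Preadditive C] [MonoidalPreadditive C]

/-- Morphisms of right modules are added in `C`. -/
instance (M N : RightMod A) : AddCommGroup (M ⟶ N) :=
  letI : Zero (M ⟶ N) := ⟨{ hom := 0, act_hom := by simp }⟩
  letI : Add (M ⟶ N) :=
    ⟨fun f g => { hom := f.hom + g.hom, act_hom := by simp [f.act_hom, g.act_hom] }⟩
  letI : Neg (M ⟶ N) :=
    ⟨fun f =>
      { hom := - f.hom
        act_hom := by
          rw [show (-f.hom) ▷ A = -(f.hom ▷ A) from (tensorRight A).map_neg]
          simp [f.act_hom] }⟩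
  { add_assoc := fun _ _ _ => hom_ext _ _ (add_assoc _ _ _)
    zero_add := fun _ => hom_ext _ _ (zero_add _)
    add_zero := fun _ => hom_ext _ _ (add_zero _)
    neg_add_cancel := fun _ => hom_ext _ _ (neg_add_cancel _)
    add_comm := fun _ _ => hom_ext _ _ (add_comm _ _)
    nsmul := nsmulRec
    zsmul := zsmulRec }

@[simp]
theorem add_hom {M N : RightMod A} (f g : M ⟶ N) : (f + g).hom = f.hom + g.hom := rfl

@[simp]
theorem zero_hom (M N : RightMod A) : (0 : M ⟶ N).hom = 0 := rfl

instance : Preadditive (RightMod A) where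
  add_comp _ _ _ _ _ _ := hom_ext _ _ (Preadditive.add_comp _ _ _ _ _ _)
  comp_add _ _ _ _ _ _ := hom_ext _ _ (Preadditive.comp_add _ _ _ _ _ _)

end Additive

end RightMod

end RightModules

/-! ### Left modules over an algebra -/

section LeftModules

variable {C : Type u} [Category.{v} C] [MonoidalCategory C] {A : C} [MonObj A]

namespace LeftMod

/-- The left module `N ⊗ X`, with `A` acting on `N`. -/
def tensor (N : Mod C A) (X : C) : Mod C A where
  X := N.X ⊗ X
  mod :=
    { smul := (α_ A N.X X).inv ≫ γ[A, N.X] ▷ X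
      one_smul := by
        change η[A] ▷ (N.X ⊗ X) ≫ (α_ A N.X X).inv ≫ γ[A, N.X] ▷ X = (λ_ (N.X ⊗ X)).hom
        simp [← comp_whiskerRight]
      mul_smul := by
        change μ[A] ▷ (N.X ⊗ X) ≫ (α_ A N.X X).inv ≫ γ[A, N.X] ▷ X =
          (α_ A A (N.X ⊗ X)).hom ≫ A ◁ ((α_ A N.X X).inv ≫ γ[A, N.X] ▷ X) ≫
            (α_ A N.X X).inv ≫ γ[A, N.X] ▷ X
        have h := congrArg (fun f => (α_ (A ⊗ A) N.X X).inv ≫ f ▷ X)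
          (ModObj.mul_smul_self A N.X)
        simp only [comp_whiskerRight] at h
        simpa using h }

/-- Left modules form a right `C`-module category under `tensor`. -/
instance : MonoidalRightAction C (Mod C A) where
  actionObj N X := tensor N X
  actionHomRight N X Y f := Mod.Hom.mk' (M := tensor N X) (N := tensor N Y) (N.X ◁ f) (by
    change ((α_ A N.X X).inv ≫ γ[A, N.X] ▷ X) ≫ N.X ◁ f =
      A ◁ N.X ◁ f ≫ (α_ A N.X Y).inv ≫ γ[A, N.X] ▷ Y
    simp [← whisker_exchange])
  actionHomLeft {M N} f X := Mod.Hom.mk' (M := tensor M X) (N := tensor N X) (f.hom ▷ X) (by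
    change ((α_ A M.X X).inv ≫ γ[A, M.X] ▷ X) ≫ f.hom ▷ X =
      A ◁ f.hom ▷ X ≫ (α_ A N.X X).inv ≫ γ[A, N.X] ▷ X
    have h : γ[A, M.X] ≫ f.hom = A ◁ f.hom ≫ γ[A, N.X] := IsModHom.smul_hom
    rw [Category.assoc, ← comp_whiskerRight, h]
    simp)
  actionAssocIso N X Y :=
    { hom := Mod.Hom.mk' (M := tensor N (X ⊗ Y)) (N := tensor (tensor N X) Y)
        (α_ N.X X Y).inv (by
          change ((α_ A N.X (X ⊗ Y)).inv ≫ γ[A, N.X] ▷ (X ⊗ Y)) ≫ (α_ N.X X Y).inv =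
            A ◁ (α_ N.X X Y).inv ≫ (α_ A (N.X ⊗ X) Y).inv ≫
              ((α_ A N.X X).inv ≫ γ[A, N.X] ▷ X) ▷ Y
          simp)
      inv := Mod.Hom.mk' (M := tensor (tensor N X) Y) (N := tensor N (X ⊗ Y))
        (α_ N.X X Y).hom (by
          change ((α_ A (N.X ⊗ X) Y).inv ≫ ((α_ A N.X X).inv ≫ γ[A, N.X] ▷ X) ▷ Y) ≫
            (α_ N.X X Y).hom =
            A ◁ (α_ N.X X Y).hom ≫ (α_ A N.X (X ⊗ Y)).inv ≫ γ[A, N.X] ▷ (X ⊗ Y)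
          simp)
      hom_inv_id := Mod.hom_ext _ _ (α_ N.X X Y).inv_hom_id
      inv_hom_id := Mod.hom_ext _ _ (α_ N.X X Y).hom_inv_id }
  actionUnitIso N :=
    { hom := Mod.Hom.mk' (M := tensor N (𝟙_ C)) (N := N) (ρ_ N.X).hom (by
        change ((α_ A N.X (𝟙_ C)).inv ≫ γ[A, N.X] ▷ 𝟙_ C) ≫ (ρ_ N.X).hom =
          A ◁ (ρ_ N.X).hom ≫ γ[A, N.X]
        simp)
      inv := Mod.Hom.mk' (M := N) (N := tensor N (𝟙_ C)) (ρ_ N.X).inv (by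
        change γ[A, N.X] ≫ (ρ_ N.X).inv =
          A ◁ (ρ_ N.X).inv ≫ (α_ A N.X (𝟙_ C)).inv ≫ γ[A, N.X] ▷ 𝟙_ C
        simp)
      hom_inv_id := Mod.hom_ext _ _ (ρ_ N.X).hom_inv_id
      inv_hom_id := Mod.hom_ext _ _ (ρ_ N.X).inv_hom_id }
  actionHomRight_id c d := Mod.hom_ext _ _ (whiskerLeft_id d.X c)
  id_actionHomLeft c d := Mod.hom_ext _ _ (id_whiskerRight d.X c)
  actionHom_comp f₁ f₂ g₁ g₂ := Mod.hom_ext _ _ (by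
    change (f₁.hom ≫ f₂.hom) ▷ _ ≫ _ ◁ (g₁ ≫ g₂) =
      (f₁.hom ▷ _ ≫ _ ◁ g₁) ≫ f₂.hom ▷ _ ≫ _ ◁ g₂
    simp [whisker_exchange_assoc])
  actionAssocIso_hom_naturality f g h := Mod.hom_ext _ _ (by
    change (f.hom ▷ _ ≫ _ ◁ (g ⊗ₘ h)) ≫ (α_ _ _ _).inv =
      (α_ _ _ _).inv ≫ (f.hom ▷ _ ≫ _ ◁ g) ▷ _ ≫ _ ◁ h
    simp [MonoidalCategory.tensorHom_def])
  actionUnitIso_hom_naturality f := Mod.hom_ext _ _ (rightUnitor_naturality f.hom).symm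
  actionHomRight_whiskerRight f c d := Mod.hom_ext _ _ 
    (MonoidalRightAction.actionHomRight_whiskerRight (D := C) f c d.X)
  whiskerRight_actionHomLeft c _ _ f d := Mod.hom_ext _ _ 
    (MonoidalRightAction.whiskerRight_actionHomLeft (D := C) c f d.X)
  actionHom_associator c₁ c₂ c₃ d := Mod.hom_ext _ _
    (MonoidalRightAction.actionHom_associator (D := C) c₁ c₂ c₃ d.X)
  actionHom_leftUnitor c d := Mod.hom_ext _ _
    (MonoidalRightAction.actionHom_leftUnitor (D := C) c d.X)
  actionHom_rightUnitor c d := Mod.hom_ext _ _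
    (MonoidalRightAction.actionHom_rightUnitor (D := C) c d.X)

section Additive

variable [Preadditive C] [MonoidalPreadditive C]

/-- Morphisms of left modules are added in `C`. -/
instance (M N : Mod C A) : AddCommGroup (M ⟶ N) :=
  letI : Zero (M ⟶ N) := ⟨Mod.Hom.mk' 0 (by simp)⟩
  letI : Add (M ⟶ N) := ⟨fun f g => Mod.Hom.mk' (f.hom + g.hom) (by simp)⟩
  letI : Neg (M ⟶ N) :=
    ⟨fun f => Mod.Hom.mk' (-f.hom) (by
      have h : A ◁ (-f.hom) = -(A ◁ f.hom) := (tensorLeft A).map_neg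
      simp [h])⟩
  { add_assoc := fun _ _ _ => Mod.hom_ext _ _ (add_assoc _ _ _)
    zero_add := fun _ => Mod.hom_ext _ _ (zero_add _)
    add_zero := fun _ => Mod.hom_ext _ _ (add_zero _)
    neg_add_cancel := fun _ => Mod.hom_ext _ _ (neg_add_cancel _)
    add_comm := fun _ _ => Mod.hom_ext _ _ (add_comm _ _)
    nsmul := nsmulRec
    zsmul := zsmulRec }

@[simp]
theorem add_hom {M N : Mod C A} (f g : M ⟶ N) : (f + g).hom = f.hom + g.hom := rfl

@[simp]
theorem zero_hom (M N : Mod C A) : (0 : M ⟶ N).hom = 0 := rfl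

instance : Preadditive (Mod C A) where
  add_comp _ _ _ _ _ _ := Mod.hom_ext _ _ (Preadditive.add_comp _ _ _ _ _ _)
  comp_add _ _ _ _ _ _ := Mod.hom_ext _ _ (Preadditive.comp_add _ _ _ _ _ _)

end Additive

end LeftMod

end LeftModules

/-! ### Essential division algebras -/

section EssentialDivision

variable {C : Type u} [Category.{v} C] [MonoidalCategory C]

/-- The free right module functor `(- ⊗ A) : C ⥤ Mod-A(C)` is essentially surjective, and `A` is
non-zero. -/
def IsRightEssentialDivisionAlgebra (A : C) [MonObj A] : Prop :=
  ¬ IsZero A ∧ (MonoidalLeftAction.actionRight C (RightMod.regular A)).EssSurj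

/-- The free left module functor `(A ⊗ -) : C ⥤ A-Mod(C)` is essentially surjective, and `A` is
non-zero. -/
def IsLeftEssentialDivisionAlgebra (A : C) [MonObj A] : Prop :=
  ¬ IsZero A ∧ (MonoidalRightAction.actionLeft C (Mod.regular A)).EssSurj

end EssentialDivision

/-! Let `m` be a non-zero object of an indecomposable semisimple left module category `D`, `R` the
internal Hom out of `m`, and `E = R m`. The algebra `E` acts on `m`, so `R` lifts to a functor `G`
from `D` to right `E`-modules. The two essential surjectivity statements are compared along `G`; it
is not necessary to know that `G` is an equivalence. Three properties of `G` suffice.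

It carries `X ⊙ₗ m` to the free module `X ⊗ E`: moving `X` across by its dual, a morphism `Y ⊙ₗ m ⟶
X ⊙ₗ m` amounts to `(Xᘁ ⊗ Y) ⊙ₗ m ⟶ m`, hence to `Xᘁ ⊗ Y ⟶ E`, hence to `Y ⟶ X ⊗ E`
(`existsUnique_action_of_leftContract_injective`, `exists_iso_leftHomModule`). It is full on
morphisms out of `X ⊙ₗ m`, since both Hom-sets are morphisms `X ⟶ R d`
(`exists_leftHomModule_map_eq`). It is faithful, because a part of an object killed by `R` receives
no non-zero morphism from any `X ⊙ₗ m`, and such a part is zero by indecomposability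
(`LeftOstrikHypothesis.isZero_of_forall_hom_eq_zero`).

The comparison is `essSurj_iff_of_isSemisimpleCategory`. If every `E`-module is free, an isomorphism
from `G (X ⊙ₗ m)` to `G d` lifts to `D`, and its generalized inverse is an inverse by faithfulness.
Conversely, an `E`-module is a cokernel of free modules; the presenting morphism lifts to `D`, where
a generalized inverse exhibits the cokernel as a direct summand, so the module lies in the image of
`G`.

The non-vanishing clause holds since `E` is zero exactly when `m` is, and a zero `m` cannot reach
the non-zero objects of `D`. Left modules are treated by the mirror image. -/

/-! ### Semisimple preadditive categories with kernels -/

section Semisimple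

variable {D : Type u'} [Category.{v'} D] [Preadditive D]

/-- The projections of a finite coproduct in a preadditive category. -/
theorem exists_projections_of_isColimit {n : ℕ} {S : Fin n → D} {X : D} {incl : ∀ i, S i ⟶ X}
    (hc : IsColimit (Cofan.mk X incl)) :
    ∃ π : ∀ i, X ⟶ S i, (∀ i, incl i ≫ π i = 𝟙 (S i)) ∧
      (∀ i j, i ≠ j → incl i ≫ π j = 0) ∧ ∑ i, π i ≫ incl i = 𝟙 X := by
  classical
  let π : ∀ j, X ⟶ S j := fun j =>
    Cofan.IsColimit.desc hc (fun i => if h : i = j then eqToHom (by rw [h]) else 0)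
  have hπ : ∀ i j, incl i ≫ π j = if h : i = j then eqToHom (by rw [h]) else 0 := fun i j =>
    Cofan.IsColimit.fac hc _ i
  refine ⟨π, fun i => by simp [hπ], fun i j h => by simp [hπ, h], ?_⟩
  refine Cofan.IsColimit.hom_ext hc _ _ fun i => ?_
  change incl i ≫ ∑ j, π j ≫ incl j = incl i ≫ 𝟙 X
  rw [Preadditive.comp_sum, Finset.sum_eq_single i]
  · simp [reassoc_of% hπ]
  · intro j _ hj
    rw [← Category.assoc, hπ, dif_neg (Ne.symm hj), zero_comp]
  · simp

namespace IsSemisimpleCategory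

variable [HasKernels D]

/-- A non-zero morphism from a simple object to a semisimple one is a split monomorphism. -/
theorem exists_retraction (hD : IsSemisimpleCategory D) {S X : D} [Simple S] {f : S ⟶ X}
    (hf : f ≠ 0) : ∃ r : X ⟶ S, f ≫ r = 𝟙 S := by
  obtain ⟨n, T, incl, hT, ⟨hc⟩⟩ := hD X
  obtain ⟨π, -, -, h⟩ := exists_projections_of_isColimit hc
  obtain ⟨i, hi⟩ : ∃ i, f ≫ π i ≠ 0 := by
    by_contra! hz
    apply hf
    rw [← Category.comp_id f, ← h, Preadditive.comp_sum]
    exact Finset.sum_eq_zero fun i _ => by rw [← Category.assoc, hz, zero_comp]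
  have := hT i
  have := isIso_of_hom_simple hi
  exact ⟨π i ≫ inv (f ≫ π i), by rw [← Category.assoc, IsIso.hom_inv_id]⟩

/-- Every morphism of a semisimple category has a generalized inverse. -/
theorem exists_generalized_inverse (hD : IsSemisimpleCategory D) {X Y : D} (g : X ⟶ Y) :
    ∃ h : Y ⟶ X, g ≫ h ≫ g = g := by
  classical
  obtain ⟨n, S, incl, hS, ⟨hc⟩⟩ := hD X
  obtain ⟨π, h₁, h₂, h₃⟩ := exists_projections_of_isColimit hc
  suffices H : ∀ (s : Finset (Fin n)) (g : X ⟶ Y), ∃ h : Y ⟶ X,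
      ((∑ i ∈ s, π i ≫ incl i) ≫ g) ≫ h ≫ (∑ i ∈ s, π i ≫ incl i) ≫ g =
        (∑ i ∈ s, π i ≫ incl i) ≫ g by
    simpa [h₃] using H Finset.univ g
  -- Induction over the simple summands of `X`, for all `g` at once: the inductive step applies the
  -- hypothesis to a modified `g`.
  intro s
  induction s using Finset.induction_on with
  | empty => exact fun g => ⟨0, by simp⟩
  | insert i s hi ih =>
    intro g
    rw [Finset.sum_insert hi]
    set e := ∑ i ∈ s, π i ≫ incl i with he
    have hie : incl i ≫ e = 0 := by
      rw [he, Preadditive.comp_sum]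
      refine Finset.sum_eq_zero fun j hj => ?_
      rw [← Category.assoc, h₂ i j (fun h => hi (h ▸ hj)), zero_comp]
    have hei : e ≫ π i = 0 := by
      rw [he, Preadditive.sum_comp]
      refine Finset.sum_eq_zero fun j hj => ?_
      rw [Category.assoc, h₂ j i (fun h => hi (h ▸ hj)), comp_zero]
    have hee : e ≫ e = e := by
      conv_lhs => rw [he, Preadditive.sum_comp]
      refine Finset.sum_congr rfl fun j hj => ?_
      rw [Category.assoc, Preadditive.comp_sum, Finset.sum_eq_single j]
      · rw [reassoc_of% (h₁ j)]
      · intro l _ hl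
        rw [← Category.assoc, h₂ j l hl.symm, zero_comp]
      · exact fun h => absurd hj h
    by_cases hg : incl i ≫ g = 0
    · obtain ⟨h, hh⟩ := ih g
      refine ⟨h, ?_⟩
      simpa [Preadditive.add_comp, hg] using hh
    · have := hS i
      obtain ⟨r, hr⟩ := hD.exists_retraction hg
      -- The `i`-th summand embeds in `Y` with retraction `r`. The remaining summands are handled
      -- after projecting `Y` away from its image.
      obtain ⟨h, hh⟩ := ih (g ≫ (𝟙 Y - r ≫ incl i ≫ g))
      have h₁' := h₁ i
      rw [Category.assoc] at hr
      have hr' : incl i ≫ g ≫ (𝟙 Y - r ≫ incl i ≫ g) = 0 := by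
        simp [Preadditive.comp_sub, reassoc_of% hr]
      set p := 𝟙 Y - r ≫ incl i ≫ g with hp
      -- Block elimination: `r` inverts the `i`-th summand, `h` the part surviving `p`, and the
      -- subtracted term removes the component of `e ≫ g` along the image of the `i`-th summand.
      refine ⟨r ≫ incl i + p ≫ h ≫ (e - e ≫ g ≫ r ≫ incl i), ?_⟩
      have key : (r ≫ incl i + p ≫ h ≫ (e - e ≫ g ≫ r ≫ incl i)) ≫ (π i ≫ incl i + e) ≫ g =
          r ≫ incl i ≫ g + p ≫ h ≫ e ≫ g ≫ p := by
        simp only [Preadditive.add_comp, Preadditive.comp_add, Preadditive.sub_comp,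
          Preadditive.comp_sub, Category.assoc, reassoc_of% h₁', reassoc_of% hie,
          reassoc_of% hei, reassoc_of% hee, zero_comp, comp_zero, hp, Category.comp_id]
        abel
      rw [key]
      have hh' : e ≫ g ≫ p ≫ h ≫ e ≫ g ≫ p = e ≫ g ≫ p := by simpa using hh
      have hgp : g ≫ p = g - g ≫ r ≫ incl i ≫ g := by simp [hp, Preadditive.comp_sub]
      simp only [Preadditive.add_comp, Preadditive.comp_add, Category.assoc, reassoc_of% hr,
        reassoc_of% hr', zero_comp, comp_zero, hh']
      rw [hgp]
      simp only [Preadditive.comp_sub]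
      abel

theorem isIdempotentComplete : IsIdempotentComplete D := by
  rw [Idempotents.isIdempotentComplete_iff_idempotents_have_kernels]
  exact fun _ _ _ => inferInstance

/-- A semisimple category is the direct sum of the objects receiving no non-zero morphism from a
given family and the objects having no non-zero morphism to those. -/
theorem isInternalDirectSum_orthogonal (hD : IsSemisimpleCategory D) (G : ObjectProperty D) :
    IsInternalDirectSum
      (fun Z => ∀ W, (∀ Y, G Y → ∀ f : Y ⟶ W, f = 0) → ∀ f : Z ⟶ W, f = 0)
      (fun W => ∀ Y, G Y → ∀ f : Y ⟶ W, f = 0) where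
  hom_eq_zero X Y hX hY f := hX Y hY f
  hom_eq_zero' X Y hX hY f := by
    -- A generalized inverse of `f` goes in the direction already known to vanish.
    obtain ⟨h, hh⟩ := hD.exists_generalized_inverse f
    rw [← hh, hX Y hY h, zero_comp, comp_zero]
  exists_decomposition Z := by
    classical
    obtain ⟨n, S, incl, hS, ⟨hc⟩⟩ := hD Z
    obtain ⟨π, h₁, h₂, h₃⟩ := exists_projections_of_isColimit hc
    let Q : D → Prop := fun W => ∀ Y, G Y → ∀ f : Y ⟶ W, f = 0
    -- Each simple summand lies on one side: a non-zero morphism to an object of `Q` makes it a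
    -- retract of that object, hence itself in `Q`.
    have hS' : ∀ i, ¬ Q (S i) → ∀ W, Q W → ∀ f : S i ⟶ W, f = 0 := by
      intro i hi W hW f
      by_contra hf
      have := hS i
      obtain ⟨r, hr⟩ := hD.exists_retraction hf
      exact hi fun Y hY g => by
        rw [← Category.comp_id g, ← hr, ← Category.assoc, hW Y hY (g ≫ f), zero_comp]
    let e : Z ⟶ Z := ∑ i with Q (S i), π i ≫ incl i
    let e' : Z ⟶ Z := ∑ i with ¬ Q (S i), π i ≫ incl i
    have hsum : e + e' = 𝟙 Z := by
      rw [← h₃]; exact Finset.sum_filter_add_sum_filter_not _ _ _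
    have hee' : e ≫ e' = 0 := by
      simp only [e, e', Preadditive.sum_comp, Preadditive.comp_sum]
      refine Finset.sum_eq_zero fun i hi => Finset.sum_eq_zero fun j hj => ?_
      have hij : j ≠ i := by
        rintro rfl; exact (Finset.mem_filter.1 hi).2 (Finset.mem_filter.1 hj).2
      simp [reassoc_of% (h₂ j i hij)]
    have he'e : e' ≫ e = 0 := by
      simp only [e, e', Preadditive.sum_comp, Preadditive.comp_sum]
      refine Finset.sum_eq_zero fun i hi => Finset.sum_eq_zero fun j hj => ?_
      have hij : j ≠ i := by
        rintro rfl; exact (Finset.mem_filter.1 hj).2 (Finset.mem_filter.1 hi).2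
      simp [reassoc_of% (h₂ j i hij)]
    have hee : e ≫ e = e := by
      have := congrArg (fun x => e ≫ x) hsum
      simpa [Preadditive.comp_add, hee'] using this
    have he'e' : e' ≫ e' = e' := by
      have := congrArg (fun x => e' ≫ x) hsum
      simpa [Preadditive.comp_add, he'e] using this
    -- The two components of `Z` are the images of the complementary idempotents `e'` and `e`.
    have hidem : IsIdempotentComplete D := isIdempotentComplete
    obtain ⟨Y, j, q, hjq, hqj⟩ := hidem.idempotents_split Z e hee
    obtain ⟨X, i, p, hip, hpi⟩ := hidem.idempotents_split Z e' he'e'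
    have hiq : i ≫ q = 0 := by
      have : i ≫ (p ≫ i) ≫ (q ≫ j) ≫ q = 0 := by
        rw [hpi, hqj, reassoc_of% he'e, zero_comp, comp_zero]
      simpa [reassoc_of% hip, hjq] using this
    have hjp : j ≫ p = 0 := by
      have : j ≫ (q ≫ j) ≫ (p ≫ i) ≫ p = 0 := by
        rw [hpi, hqj, reassoc_of% hee', zero_comp, comp_zero]
      simpa [reassoc_of% hjq, hip] using this
    refine ⟨X, Y, i, j, fun W hW f => ?_, fun T hT f => ?_, ⟨?_⟩⟩
    · have hf : f = i ≫ e' ≫ p ≫ f := by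
        rw [← hpi]; simp [reassoc_of% hip]
      rw [hf]
      simp only [e', Preadditive.sum_comp, Preadditive.comp_sum]
      refine Finset.sum_eq_zero fun l hl => ?_
      have := hS' l (Finset.mem_filter.1 hl).2 W hW (incl l ≫ p ≫ f)
      simp [this]
    · have hf : f = f ≫ j ≫ e ≫ q := by
        rw [← hqj]; simp [hjq]
      rw [hf]
      simp only [e, Preadditive.sum_comp, Preadditive.comp_sum]
      refine Finset.sum_eq_zero fun l hl => ?_
      have := (Finset.mem_filter.1 hl).2 T hT (f ≫ j ≫ π l)
      simp only [Category.assoc] at this ⊢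
      rw [reassoc_of% this, zero_comp]
    · refine BinaryCofan.IsColimit.mk _ (fun f g => p ≫ f + q ≫ g) ?_ ?_ ?_
      · intro T f g
        change i ≫ (p ≫ f + q ≫ g) = f
        simp [reassoc_of% hip, reassoc_of% hiq]
      · intro T f g
        change j ≫ (p ≫ f + q ≫ g) = g
        simp [reassoc_of% hjq, reassoc_of% hjp]
      · intro T f g (m : Z ⟶ T) hf hg
        have h₁ : i ≫ m = f := hf
        have h₂ : j ≫ m = g := hg
        rw [← h₁, ← h₂, ← Category.assoc, ← Category.assoc, hpi, hqj, ← Preadditive.add_comp,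
          add_comm, hsum, Category.id_comp]

end IsSemisimpleCategory

/-! ### Transfer of essential surjectivity along a faithful functor -/

/-- In a semisimple category, a right adjoint of `F` is faithful as soon as only zero objects
receive no non-zero morphism from the image of `F`. -/
theorem faithful_rightAdjoint_of_isSemisimpleCategory [HasKernels D] (hD : IsSemisimpleCategory D)
    {C : Type u} [Category.{v} C] [Preadditive C] {F : C ⥤ D} [F.Additive] {R : D ⥤ C}
    (adj : F ⊣ R) (h : ∀ W : D, (∀ X (f : F.obj X ⟶ W), f = 0) → IsZero W) : R.Faithful := by
  have hR : R.Additive := adj.right_adjoint_additive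
  suffices H : ∀ {a b : D} (f : a ⟶ b), R.map f = 0 → f = 0 by
    refine ⟨fun {a b f g} hfg => sub_eq_zero.1 (H _ ?_)⟩
    rw [R.map_sub, hfg, sub_self]
  intro a b f hf
  obtain ⟨g, hg⟩ := hD.exists_generalized_inverse f
  have hidem : IsIdempotentComplete D := IsSemisimpleCategory.isIdempotentComplete
  -- `Z` is the summand of `a` on which `f` is a split monomorphism. A morphism from `F.obj X` to
  -- `Z` followed by `f` has zero transpose, since `R.map f = 0`, so it was zero already.
  obtain ⟨Z, i, p, hip, hpi⟩ := hidem.idempotents_split a (f ≫ g) (by simp [reassoc_of% hg])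
  have hZ : IsZero Z := h Z fun X u => by
    have h0 : (u ≫ i) ≫ f = 0 := by
      apply (adj.homEquiv _ _).injective
      rw [adj.homEquiv_naturality_right, hf, comp_zero, adj.homEquiv_unit, Functor.map_zero,
        comp_zero]
    have hu : u = ((u ≫ i) ≫ f) ≫ g ≫ p := by
      have : u = u ≫ i ≫ (p ≫ i) ≫ p := by simp [hip]
      rw [hpi] at this
      simpa using this
    rw [hu, h0, zero_comp]
  have : f ≫ g = 0 := by rw [← hpi, hZ.eq_of_src i 0, comp_zero]
  rw [← hg, ← Category.assoc, this, zero_comp]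

/-- Let `G : D ⥤ E` be faithful, fully faithful on morphisms out of the image of `F : C ⥤ D`, and
let `G` carry `F` to `L : C ⥤ E`. If `D` is semisimple and every object of `E` is a cokernel of a
morphism between objects in the image of `L`, then `L` is essentially surjective if and only if
`F` is. -/
theorem essSurj_iff_of_isSemisimpleCategory [HasKernels D] (hD : IsSemisimpleCategory D)
    {C : Type u} [Category.{v} C] {E : Type*} [Category* E] [Preadditive E] {F : C ⥤ D}
    {L : C ⥤ E} {G : D ⥤ E} [G.Faithful] [G.Additive] (θ : ∀ X, L.obj X ≅ G.obj (F.obj X))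
    (hfull : ∀ X (d : D) (φ : G.obj (F.obj X) ⟶ G.obj d), ∃ f, G.map f = φ)
    (hpres : ∀ P : E, ∃ (X Y : C) (g : L.obj Y ⟶ L.obj X) (p : L.obj X ⟶ P) (_ : g ≫ p = 0)
      (_ : Epi p), ∀ k : L.obj X ⟶ L.obj X, g ≫ k = 0 → ∃ s, p ≫ s = k) :
    L.EssSurj ↔ F.EssSurj := by
  constructor
  · refine fun hL => ⟨fun d => ?_⟩
    obtain ⟨X, ⟨e⟩⟩ := hL.mem_essImage (G.obj d)
    obtain ⟨f, hf⟩ := hfull X d ((θ X).inv ≫ e.hom)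
    obtain ⟨h, hh⟩ := hD.exists_generalized_inverse f
    have hiso : IsIso (G.map f) := by rw [hf]; infer_instance
    -- In `f ≫ h ≫ f = f` one factor `f` can be cancelled after applying `G`, as `G.map f` is
    -- invertible.
    have h₁ : f ≫ h = 𝟙 _ := by
      apply G.map_injective
      rw [← cancel_mono (G.map f), ← G.map_comp, Category.assoc, hh]
      simp
    have h₂ : h ≫ f = 𝟙 _ := by
      apply G.map_injective
      rw [← cancel_epi (G.map f), ← G.map_comp, hh]
      simp
    exact ⟨X, ⟨⟨f, h, h₁, h₂⟩⟩⟩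
  · refine fun hF => ⟨fun P => ?_⟩
    obtain ⟨X, Y, g, p, hgp, _, hp⟩ := hpres P
    obtain ⟨g', hg'⟩ := hfull Y (F.obj X) ((θ Y).inv ≫ g ≫ (θ X).hom)
    obtain ⟨h', hh'⟩ := hD.exists_generalized_inverse g'
    -- The idempotent `𝟙 - h' ≫ g'` is killed by `g'` on the left and differs from the identity by a
    -- multiple of `g'`, so its image under `G` is a model of the cokernel `P`.
    have hgk : g ≫ (θ X).hom ≫ G.map (𝟙 _ - h' ≫ g') ≫ (θ X).inv = 0 := by
      have h0 : G.map (g' ≫ (𝟙 _ - h' ≫ g')) = 0 := by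
        rw [Preadditive.comp_sub, hh', Category.comp_id, sub_self, G.map_zero]
      rw [G.map_comp, hg'] at h0
      simp only [Category.assoc] at h0
      have := congrArg (fun x => (θ Y).hom ≫ x ≫ (θ X).inv) h0
      simpa using this
    obtain ⟨s, hs⟩ := hp _ hgk
    have hsp : s ≫ p = 𝟙 P := by
      rw [← cancel_epi p, ← Category.assoc, hs, G.map_sub, G.map_comp, hg']
      simp [Preadditive.comp_sub, Preadditive.sub_comp, hgp]
    have hidem : IsIdempotentComplete D := IsSemisimpleCategory.isIdempotentComplete
    obtain ⟨d, i, q, hiq, hqi⟩ := hidem.idempotents_split _ (𝟙 _ - h' ≫ g')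
      (by simp [Preadditive.comp_sub, Preadditive.sub_comp, hh'])
    obtain ⟨Z, ⟨e⟩⟩ := hF.mem_essImage d
    have hs' : p ≫ s = (θ X).hom ≫ G.map q ≫ G.map i ≫ (θ X).inv := by
      rw [hs, ← hqi, G.map_comp, Category.assoc]
    have hGiq : G.map i ≫ G.map q = 𝟙 _ := by rw [← G.map_comp, hiq, G.map_id]
    have e' : G.obj d ≅ P :=
      { hom := G.map i ≫ (θ X).inv ≫ p
        inv := s ≫ (θ X).hom ≫ G.map q
        hom_inv_id := by
          simp only [Category.assoc, reassoc_of% hs', Iso.inv_hom_id_assoc, reassoc_of% hGiq,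
            hGiq]
        inv_hom_id := by
          have : s ≫ (p ≫ s) ≫ p = 𝟙 P := by rw [Category.assoc, hsp, Category.comp_id, hsp]
          rw [hs'] at this
          simpa using this }
    exact ⟨Z, ⟨θ Z ≪≫ G.mapIso e ≪≫ e'⟩⟩

end Semisimple

/-! ### Internal Homs in left module categories -/

section LeftInternalHom

open MonoidalLeftAction

variable {C : Type u} [Category.{v} C] [MonoidalCategory C]

/-! ### Free right modules and the bar presentation -/

namespace RightMod

variable {E : C} [MonObj E]

/-- Insert the unit next to the given factor `E`, use linearity, and cancel by `η · x = x`. -/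
theorem eq_of_tensor_regular_linear {X : C} (N : RightMod E) {f : X ⊗ E ⟶ N.X}
    (hf : ((α_ X E E).hom ≫ X ◁ μ[E]) ≫ f = f ▷ E ≫ N.act) :
    f = ((ρ_ X).inv ≫ X ◁ η[E] ≫ f) ▷ E ≫ N.act := by
  simp only [comp_whiskerRight, Category.assoc]
  rw [← hf]
  simp [← whiskerLeft_comp_assoc]

/-- A morphism out of a free right module is determined by its restriction to the generators. -/
theorem tensor_regular_hom_ext {X : C} {N : RightMod E} {f g : tensor X (regular E) ⟶ N}
    (h : (ρ_ X).inv ≫ X ◁ η[E] ≫ Hom.hom f = (ρ_ X).inv ≫ X ◁ η[E] ≫ Hom.hom g) : f = g := by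
  apply hom_ext
  refine (eq_of_tensor_regular_linear N f.act_hom).trans
    (Eq.trans ?_ (eq_of_tensor_regular_linear N g.act_hom).symm)
  exact congrArg (fun x => x ▷ E ≫ N.act) h

/-- Every right module is the cokernel of a morphism between free right modules. -/
theorem exists_free_presentation [Preadditive C] [MonoidalPreadditive C] (P : RightMod E) :
    ∃ (X Y : C) (g : tensor Y (regular E) ⟶ tensor X (regular E))
      (p : tensor X (regular E) ⟶ P) (_ : g ≫ p = 0) (_ : Epi p),
      ∀ k : tensor X (regular E) ⟶ tensor X (regular E), g ≫ k = 0 → ∃ s, p ≫ s = k := by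
  -- The bar presentation: `p` is the action, and `g₁`, `g₂` are the two faces `P ⊗ E ⊗ E ⟶ P ⊗ E`,
  -- acting on `P` and multiplying in `E`.
  let p : tensor P.X (regular E) ⟶ P := ⟨P.act, by simp [tensor, regular, P.act_mul]⟩
  let g₁ : tensor (P.X ⊗ E) (regular E) ⟶ tensor P.X (regular E) :=
    ⟨P.act ▷ E, by
      change ((α_ (P.X ⊗ E) E E).hom ≫ (P.X ⊗ E) ◁ μ[E]) ≫ P.act ▷ E =
        P.act ▷ E ▷ E ≫ (α_ P.X E E).hom ≫ P.X ◁ μ[E]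
      rw [Category.assoc, whisker_exchange]
      simp⟩
  let g₂ : tensor (P.X ⊗ E) (regular E) ⟶ tensor P.X (regular E) :=
    ⟨(α_ P.X E E).hom ≫ P.X ◁ μ[E], by
      change ((α_ (P.X ⊗ E) E E).hom ≫ (P.X ⊗ E) ◁ μ[E]) ≫ (α_ P.X E E).hom ≫ P.X ◁ μ[E] =
        ((α_ P.X E E).hom ≫ P.X ◁ μ[E]) ▷ E ≫ (α_ P.X E E).hom ≫ P.X ◁ μ[E]
      simp only [comp_whiskerRight, whisker_assoc, Category.assoc, Iso.inv_hom_id_assoc,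
        tensor_whiskerLeft]
      rw [← whiskerLeft_comp, ← whiskerLeft_comp, MonObj.mul_assoc]
      simp only [whiskerLeft_comp, pentagon_assoc]⟩
  have hu : (ρ_ P.X).inv ≫ P.X ◁ η[E] ≫ P.act = 𝟙 P.X := by rw [P.act_one, Iso.inv_hom_id]
  refine ⟨P.X, P.X ⊗ E, g₁ - g₂, p, ?_, ⟨fun {Z} a b hab => ?_⟩, fun k hk => ?_⟩
  · rw [Preadditive.sub_comp, sub_eq_zero]
    apply hom_ext
    change P.act ▷ E ≫ P.act = ((α_ P.X E E).hom ≫ P.X ◁ μ[E]) ≫ P.act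
    simp [P.act_mul]
  · apply hom_ext
    have hab' : P.act ≫ Hom.hom a = P.act ≫ Hom.hom b := congrArg Hom.hom hab
    have := congrArg (fun x => (ρ_ P.X).inv ≫ P.X ◁ η[E] ≫ x) hab'
    simpa [reassoc_of% hu] using this
  · rw [Preadditive.sub_comp, sub_eq_zero] at hk
    obtain ⟨f, hf⟩ : ∃ f : P.X ⊗ E ⟶ P.X ⊗ E, f = Hom.hom k := ⟨_, rfl⟩
    have hk' : P.act ▷ E ≫ f = ((α_ P.X E E).hom ≫ P.X ◁ μ[E]) ≫ f := by
      rw [hf]; exact congrArg Hom.hom hk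
    -- Inserting the unit in the last factor `E` turns the equality of faces into a factorization of
    -- `f` through the action.
    have hpf : P.act ≫ (ρ_ P.X).inv ≫ P.X ◁ η[E] ≫ f = f := by
      have := congrArg (fun x => (ρ_ _).inv ≫ (P.X ⊗ E) ◁ η[E] ≫ x) hk'
      simp only [whisker_exchange_assoc] at this
      simpa [← whiskerLeft_comp_assoc] using this
    refine ⟨⟨(ρ_ P.X).inv ≫ P.X ◁ η[E] ≫ f, ?_⟩, hom_ext _ _ (hpf.trans hf)⟩
    -- Given `hpf`, linearity of the factorization says that `f` is recovered from its restriction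
    -- to the generators.
    refine hpf.trans (eq_of_tensor_regular_linear (tensor P.X (regular E)) ?_)
    rw [hf]
    exact k.act_hom

end RightMod

/-! ### The internal Hom as a functor to right modules -/

variable {D : Type u'} [Category.{v'} D] [MonoidalLeftAction C D] {m : D} {R : D ⥤ C}
  (adj : actionRight C m ⊣ R)

/-- The evaluation `R d ⊙ₗ m ⟶ d`. -/
def leftHomEv (d : D) : R.obj d ⊙ₗ m ⟶ d := adj.counit.app d

/-- The morphism `X ⟶ R d` corresponding to `f : X ⊙ₗ m ⟶ d`. -/
def leftHomCurry {X : C} {d : D} (f : X ⊙ₗ m ⟶ d) : X ⟶ R.obj d := adj.homEquiv X d f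

theorem leftHomCurry_ev {X : C} {d : D} (f : X ⊙ₗ m ⟶ d) :
    leftHomCurry adj f ⊵ₗ m ≫ leftHomEv adj d = f :=
  (adj.homEquiv_counit (g := adj.homEquiv X d f)).symm.trans
    ((adj.homEquiv X d).symm_apply_apply f)

theorem leftHom_ext {X : C} {d : D} {f g : X ⟶ R.obj d}
    (h : f ⊵ₗ m ≫ leftHomEv adj d = g ⊵ₗ m ≫ leftHomEv adj d) : f = g := by
  apply (adj.homEquiv X d).symm.injective
  rw [adj.homEquiv_counit, adj.homEquiv_counit]
  exact h

theorem leftHom_map_ev {d d' : D} (f : d ⟶ d') :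
    R.map f ⊵ₗ m ≫ leftHomEv adj d' = leftHomEv adj d ≫ f :=
  adj.counit.naturality f

variable (E : C) [MonObj E] [ModObj E m]

/-- The right action of `E` on the internal Hom from `m` to `d`. -/
def leftHomAct (d : D) : R.obj d ⊗ E ⟶ R.obj d :=
  leftHomCurry adj ((αₗ (R.obj d) E m).hom ≫ R.obj d ⊴ₗ γ[E, m] ≫ leftHomEv adj d)

theorem leftHomAct_ev (d : D) :
    leftHomAct adj E d ⊵ₗ m ≫ leftHomEv adj d =
      (αₗ (R.obj d) E m).hom ≫ R.obj d ⊴ₗ γ[E, m] ≫ leftHomEv adj d :=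
  leftHomCurry_ev adj _

/-- If `E` acts on `m`, then the internal Hom out of `m` takes values in right `E`-modules. -/
def leftHomModule : D ⥤ RightMod E where
  obj d :=
    { X := R.obj d
      act := leftHomAct adj E d
      act_one := by
        apply leftHom_ext adj
        rw [comp_actionHomLeft, Category.assoc, leftHomAct_ev, whiskerLeft_actionHomLeft]
        simp only [Category.assoc, Iso.inv_hom_id_assoc]
        rw [← actionHomRight_comp_assoc, ModObj.one_smul]
        simp
      act_mul := by
        apply leftHom_ext adj
        simp only [comp_actionHomLeft, Category.assoc, leftHomAct_ev]
        rw [whiskerRight_actionHomLeft, whiskerLeft_actionHomLeft]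
        simp only [Category.assoc, Iso.inv_hom_id_assoc]
        rw [← action_exchange_assoc, leftHomAct_ev, ← actionHomRight_comp_assoc,
          ModObj.mul_smul]
        simp only [actionHomRight_comp, Category.assoc, tensor_actionHomRight,
          Iso.inv_hom_id_assoc]
        rw [← associator_actionHom_assoc, inv_hom_actionHomLeft_assoc] }
  map {d d'} f :=
    { hom := R.map f
      act_hom := by
        apply leftHom_ext adj
        simp only [comp_actionHomLeft, Category.assoc, leftHomAct_ev, leftHom_map_ev]
        rw [reassoc_of% (leftHomAct_ev adj E), whiskerRight_actionHomLeft]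
        simp only [Category.assoc, Iso.inv_hom_id_assoc]
        rw [← action_exchange_assoc, leftHom_map_ev] }
  map_id d := RightMod.hom_ext _ _ (R.map_id d)
  map_comp f g := RightMod.hom_ext _ _ (R.map_comp f g)

/-- The canonical morphism from `X ⊗ E` to the internal Hom from `m` to `X ⊙ₗ m`. -/
def toLeftHom (X : C) : X ⊗ E ⟶ R.obj (X ⊙ₗ m) :=
  leftHomCurry adj ((αₗ X E m).hom ≫ X ⊴ₗ γ[E, m])

/-- Transposed, both sides let the two factors `E` act on `m` one after the other. -/
theorem toLeftHom_linear (X : C) :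
    ((α_ X E E).hom ≫ X ◁ μ[E]) ≫ toLeftHom adj E X =
      toLeftHom adj E X ▷ E ≫ leftHomAct adj E (X ⊙ₗ m) := by
  apply leftHom_ext adj
  dsimp only [toLeftHom]
  simp only [comp_actionHomLeft, Category.assoc, leftHomCurry_ev, leftHomAct_ev]
  rw [whiskerRight_actionHomLeft, whiskerLeft_actionHomLeft]
  simp only [Category.assoc, Iso.inv_hom_id_assoc]
  rw [← action_exchange_assoc, leftHomCurry_ev, ← actionHomRight_comp, ModObj.mul_smul]
  simp only [actionHomRight_comp, tensor_actionHomRight, Category.assoc, Iso.inv_hom_id_assoc]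
  rw [associator_actionHom_assoc]

/-- The right-hand side is the unit of the adjunction; this matches evaluation at the generators of
a free module with transposition. -/
theorem unit_toLeftHom (X : C) :
    (ρ_ X).inv ≫ X ◁ η[E] ≫ toLeftHom adj E X = leftHomCurry adj (𝟙 (X ⊙ₗ m)) := by
  apply leftHom_ext adj
  simp only [comp_actionHomLeft, Category.assoc, leftHomCurry_ev, toLeftHom]
  rw [whiskerLeft_actionHomLeft]
  simp only [Category.assoc, Iso.inv_hom_id_assoc]
  rw [← actionHomRight_comp, ModObj.one_smul, ← rightUnitor_actionHom, inv_hom_actionHomLeft]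

/-- If `(X ⊗ E) ⊙ₗ m ⟶ X ⊙ₗ m` is universal, then the internal Hom from `m` to `X ⊙ₗ m` is the
free right `E`-module on `X`. -/
theorem exists_iso_leftHomModule (X : C)
    (huniv : ∀ (Y : C) (f : Y ⊙ₗ m ⟶ X ⊙ₗ m),
      ∃! u : Y ⟶ X ⊗ E, u ⊵ₗ m ≫ (αₗ X E m).hom ≫ X ⊴ₗ γ[E, m] = f) :
    ∃ θ : RightMod.tensor X (RightMod.regular E) ≅ (leftHomModule adj E).obj (X ⊙ₗ m),
      RightMod.Hom.hom θ.hom = toLeftHom adj E X := by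
  -- `X ⊗ E` and `R.obj (X ⊙ₗ m)` represent the same functor, so the inverse is the lift of the
  -- evaluation; its linearity follows by conjugating `hl`.
  obtain ⟨u, hu, -⟩ := huniv (R.obj (X ⊙ₗ m)) (leftHomEv adj _)
  have h₁ : u ≫ toLeftHom adj E X = 𝟙 _ := by
    apply leftHom_ext adj
    rw [comp_actionHomLeft, Category.assoc, toLeftHom, leftHomCurry_ev, hu, id_actionHomLeft,
      Category.id_comp]
  have h₂ : toLeftHom adj E X ≫ u = 𝟙 _ := by
    apply (huniv (X ⊗ E) ((αₗ X E m).hom ≫ X ⊴ₗ γ[E, m])).unique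
    · rw [comp_actionHomLeft, Category.assoc, hu, toLeftHom, leftHomCurry_ev]
    · rw [id_actionHomLeft, Category.id_comp]
  have hl := toLeftHom_linear adj E X
  refine ⟨⟨⟨toLeftHom adj E X, hl⟩, ⟨u, ?_⟩, RightMod.hom_ext _ _ h₂, RightMod.hom_ext _ _ h₁⟩,
    rfl⟩
  have := congrArg (fun x => u ▷ E ≫ x ≫ u) hl
  simp only [Category.assoc, h₂, Category.comp_id] at this
  rw [← comp_whiskerRight_assoc, h₁, id_whiskerRight, Category.id_comp] at this
  exact this.symm

/-- A linear morphism out of a free module is its value on the generators, a morphism `X ⟶ R.obj d`,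
whose transpose is the required `f`. -/
theorem exists_leftHomModule_map_eq {X : C} {d : D}
    (θ : RightMod.tensor X (RightMod.regular E) ≅ (leftHomModule adj E).obj (X ⊙ₗ m))
    (hθ : RightMod.Hom.hom θ.hom = toLeftHom adj E X)
    (φ : (leftHomModule adj E).obj (X ⊙ₗ m) ⟶ (leftHomModule adj E).obj d) :
    ∃ f : X ⊙ₗ m ⟶ d, (leftHomModule adj E).map f = φ := by
  obtain ⟨ψ, hψ⟩ : ∃ ψ : R.obj (X ⊙ₗ m) ⟶ R.obj d, ψ = RightMod.Hom.hom φ := ⟨_, rfl⟩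
  refine ⟨(leftHomCurry adj (𝟙 (X ⊙ₗ m)) ≫ ψ) ⊵ₗ m ≫ leftHomEv adj d, ?_⟩
  rw [← cancel_epi θ.hom]
  apply RightMod.tensor_regular_hom_ext
  simp only [RightMod.comp_hom, hθ, ← hψ]
  change (ρ_ X).inv ≫ X ◁ η[E] ≫ toLeftHom adj E X ≫ R.map _ =
    (ρ_ X).inv ≫ X ◁ η[E] ≫ toLeftHom adj E X ≫ ψ
  have hx := unit_toLeftHom adj E X
  have hx' := congrArg (· ≫ ψ) hx
  have hx'' := congrArg
    (· ≫ R.map ((leftHomCurry adj (𝟙 (X ⊙ₗ m)) ≫ ψ) ⊵ₗ m ≫ leftHomEv adj d)) hx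
  simp only [Category.assoc] at hx' hx''
  rw [hx', hx'']
  apply leftHom_ext adj
  rw [comp_actionHomLeft, Category.assoc, leftHom_map_ev, reassoc_of% (leftHomCurry_ev adj),
    Category.id_comp]

/-- Let `E` act on `m` so that `(X ⊗ E) ⊙ₗ m ⟶ X ⊙ₗ m` is universal among the morphisms
`Y ⊙ₗ m ⟶ X ⊙ₗ m`. If the internal Hom out of `m` is faithful, then the free right `E`-module
functor is essentially surjective if and only if `(- ⊙ₗ m)` is. -/
theorem essSurj_free_iff_left (adj : actionRight C m ⊣ R) [Preadditive C] [MonoidalPreadditive C] [Preadditive D]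
    [HasKernels D] (hD : IsSemisimpleCategory D) [(actionRight C m).Additive] [R.Faithful]
    (huniv : ∀ (X Y : C) (f : Y ⊙ₗ m ⟶ X ⊙ₗ m),
      ∃! u : Y ⟶ X ⊗ E, u ⊵ₗ m ≫ (αₗ X E m).hom ≫ X ⊴ₗ γ[E, m] = f) :
    (actionRight C (RightMod.regular E)).EssSurj ↔ (actionRight C m).EssSurj := by
  have hR : R.Additive := adj.right_adjoint_additive
  have : (leftHomModule adj E).Faithful :=
    ⟨fun h => R.map_injective (congrArg RightMod.Hom.hom h)⟩
  have : (leftHomModule adj E).Additive := ⟨RightMod.hom_ext _ _ R.map_add⟩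
  choose θ hθ using fun X => exists_iso_leftHomModule adj E X (huniv X)
  refine essSurj_iff_of_isSemisimpleCategory (G := leftHomModule adj E) hD θ
    (fun X d φ => exists_leftHomModule_map_eq adj E (θ X) (hθ X) φ)
    RightMod.exists_free_presentation

end LeftInternalHom

/-! ### Left module categories over a rigid category -/

section LeftDuality

open MonoidalLeftAction

variable {C : Type u} [Category.{v} C] [MonoidalCategory C] [RigidCategory C]
  {D : Type u'} [Category.{v'} D] [MonoidalLeftAction C D]

/-- The morphism `Xᘁ ⊙ₗ Z ⟶ d` corresponding to `f : Z ⟶ X ⊙ₗ d`. -/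
def leftContract {X : C} {Z d : D} (f : Z ⟶ X ⊙ₗ d) : (Xᘁ : C) ⊙ₗ Z ⟶ d :=
  (Xᘁ : C) ⊴ₗ f ≫ (αₗ (Xᘁ : C) X d).inv ≫ ε_ X (Xᘁ : C) ⊵ₗ d ≫ (λₗ d).hom

/-- The morphism `Z ⟶ ᘁX ⊙ₗ d` corresponding to `f : X ⊙ₗ Z ⟶ d`. -/
def leftExpand {X : C} {Z d : D} (f : X ⊙ₗ Z ⟶ d) : Z ⟶ (ᘁX : C) ⊙ₗ d :=
  (λₗ Z).inv ≫ η_ (ᘁX : C) X ⊵ₗ Z ≫ (αₗ (ᘁX : C) X Z).hom ≫ (ᘁX : C) ⊴ₗ f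

/-- Contraction trades `u` for its mate under the duality of `X`, reducing universality over `X` to
universality of `g`. -/
theorem leftContract_action {X Y E : C} {m d : D} (u : Y ⟶ X ⊗ E) (g : E ⊙ₗ m ⟶ d) :
    leftContract (u ⊵ₗ m ≫ (αₗ X E m).hom ≫ X ⊴ₗ g) =
      (αₗ (Xᘁ : C) Y m).inv ≫ (tensorLeftHomEquiv Y X (Xᘁ : C) E).symm u ⊵ₗ m ≫ g := by
  have h : (tensorLeftHomEquiv Y X (Xᘁ : C) E).symm u =
    (Xᘁ : C) ◁ u ≫ (α_ (Xᘁ : C) X E).inv ≫ ε_ X (Xᘁ : C) ▷ E ≫ (λ_ E).hom := rfl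
  rw [h, leftContract]
  simp only [comp_actionHomLeft, actionHomRight_comp, Category.assoc, leftUnitor_actionHom]
  rw [whiskerRight_actionHomLeft, whiskerLeft_actionHomLeft]
  simp only [Category.assoc, Iso.inv_hom_id_assoc]
  rw [actionUnitIso_hom_naturality, ← action_exchange_assoc, tensor_actionHomRight]
  simp only [Category.assoc]
  have hα : (αₗ (Xᘁ : C) (X ⊗ E) m).inv ≫ (α_ (Xᘁ : C) X E).inv ⊵ₗ m ≫ (αₗ ((Xᘁ : C) ⊗ X) E m).hom =
      (Xᘁ : C) ⊴ₗ (αₗ X E m).hom ≫ (αₗ (Xᘁ : C) X (E ⊙ₗ m)).inv := by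
    rw [Iso.inv_comp_eq, ← Category.assoc ((αₗ _ _ _).hom), Iso.eq_comp_inv]
    have := associator_actionHom (Xᘁ : C) X E m
    rw [Category.assoc, ← this, inv_hom_actionHomLeft_assoc]
  rw [reassoc_of% hα, Iso.inv_hom_id_assoc]

/-- If the algebra `E` acts on `m` by a universal morphism `E ⊙ₗ m ⟶ m`, then
`(X ⊗ E) ⊙ₗ m ⟶ X ⊙ₗ m` is universal for every `X`. -/
theorem existsUnique_action_of_leftContract_injective
    (hinj : ∀ (X : C) (Z d : D), Function.Injective (leftContract : (Z ⟶ X ⊙ₗ d) → _))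
    {E : C} {m : D} (g : E ⊙ₗ m ⟶ m)
    (hg : ∀ (Y : C) (f : Y ⊙ₗ m ⟶ m), ∃! u : Y ⟶ E, u ⊵ₗ m ≫ g = f)
    (X Y : C) (f : Y ⊙ₗ m ⟶ X ⊙ₗ m) :
    ∃! u : Y ⟶ X ⊗ E, u ⊵ₗ m ≫ (αₗ X E m).hom ≫ X ⊴ₗ g = f := by
  have key : ∀ u : Y ⟶ X ⊗ E, u ⊵ₗ m ≫ (αₗ X E m).hom ≫ X ⊴ₗ g = f ↔
      (tensorLeftHomEquiv Y X (Xᘁ : C) E).symm u ⊵ₗ m ≫ g = (αₗ (Xᘁ : C) Y m).hom ≫ leftContract f := by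
    intro u
    rw [← (hinj X _ _).eq_iff, leftContract_action, Iso.inv_comp_eq]
  obtain ⟨w, hw, hw'⟩ := hg _ ((αₗ (Xᘁ : C) Y m).hom ≫ leftContract f)
  refine ⟨tensorLeftHomEquiv Y X (Xᘁ : C) E w, (key _).2 (by simpa using hw), fun u hu => ?_⟩
  rw [← hw' _ ((key u).1 hu), Equiv.apply_symm_apply]

variable [Preadditive D]

/-- In an indecomposable semisimple module category, a non-zero object generates. -/
theorem LeftOstrikHypothesis.isZero_of_forall_hom_eq_zero [HasKernels D]
    (hD : LeftOstrikHypothesis C D)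
    (hcontract : ∀ (X : C) (Z d : D) (f : Z ⟶ X ⊙ₗ d), leftContract f = 0 → f = 0)
    (hexpand : ∀ (X : C) (Z d : D) (f : X ⊙ₗ Z ⟶ d), leftExpand f = 0 → f = 0)
    {m : D} (hm : ¬ IsZero m) {W : D} (hW : ∀ (X : C) (f : X ⊙ₗ m ⟶ W), f = 0) : IsZero W := by
  -- `Q` is the right orthogonal of the objects `X ⊙ₗ m`, and `P` the left orthogonal of `Q`. As `P`
  -- contains the non-zero `m`, indecomposability forces `Q`, which contains `W`, to vanish.
  let G : ObjectProperty D := fun Y => ∃ X : C, Y = X ⊙ₗ m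
  let Q : ObjectProperty D := fun W => ∀ Y, G Y → ∀ f : Y ⟶ W, f = 0
  let P : ObjectProperty D := fun Z => ∀ W, Q W → ∀ f : Z ⟶ W, f = 0
  have hQ : Q W := by rintro _ ⟨X, rfl⟩ f; exact hW X f
  have hPm : P m := fun W hW f => by
    rw [← cancel_epi (λₗ[C] m).hom, comp_zero]
    exact hW _ ⟨_, rfl⟩ _
  have hPiso : P.IsClosedUnderIsomorphisms := ⟨fun e h W hW f => by
    rw [← cancel_epi e.hom, comp_zero]; exact h W hW _⟩
  have hQiso : Q.IsClosedUnderIsomorphisms := ⟨fun e h Y hY f => by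
    rw [← cancel_mono e.inv, zero_comp]; exact h Y hY _⟩
  -- Duality moves `c` to the source, where `cᘁ ⊙ₗ (Y ⊙ₗ m)` is again of the form `X ⊙ₗ m`. For `P`
  -- the other dual moves `c` to the target, and stability of `Q` applies.
  have hQact : ∀ (c : C) (X : D), Q X → Q (c ⊙ₗ X) := by
    rintro c X hX _ ⟨Y, rfl⟩ f
    apply hcontract
    rw [← cancel_epi (αₗ (cᘁ : C) Y m).hom, comp_zero]
    exact hX _ ⟨_, rfl⟩ _
  have hPact : ∀ (c : C) (X : D), P X → P (c ⊙ₗ X) := fun c X hX W hW f =>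
    hexpand _ _ _ _ (hX _ (hQact _ _ hW) _)
  rcases hD.indecomposable P Q hPiso hQiso hPact hQact
    (hD.semisimple.isInternalDirectSum_orthogonal G) with h | h
  · exact absurd (h m hPm) hm
  · exact h W hQ

/-- The internal End of an object `m` of an indecomposable semisimple left module category is a
right essential division algebra if and only if `(- ⊙ₗ m)` is essentially surjective. -/
theorem LeftOstrikHypothesis.isRightEssentialDivisionAlgebra_iff [Preadditive C]
    [MonoidalPreadditive C] [HasKernels D]
    (hD : LeftOstrikHypothesis C D)
    (hcontract : ∀ (X : C) (Z d : D), Function.Injective (leftContract : (Z ⟶ X ⊙ₗ d) → _))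
    (hcontract' : ∀ (X : C) (Z d : D) (f : Z ⟶ X ⊙ₗ d), leftContract f = 0 → f = 0)
    (hexpand : ∀ (X : C) (Z d : D) (f : X ⊙ₗ Z ⟶ d), leftExpand f = 0 → f = 0)
    (m : D) [(actionRight C m).Additive] {R : D ⥤ C} (adj : actionRight C m ⊣ R) :
    @IsRightEssentialDivisionAlgebra C _ _ (R.obj m) (leftInternalEnd m adj) ↔
      (actionRight C m).EssSurj := by
  let : MonObj (R.obj m) := leftInternalEnd m adj
  let : ModObj (R.obj m) m :=
    { smul := leftEv m adj
      one_smul := leftCurry_ev m adj _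
      mul_smul := leftCurry_ev m adj _ }
  have huniv := existsUnique_action_of_leftContract_injective hcontract (leftEv m adj)
    fun Y f => ⟨leftCurry m adj f, leftCurry_ev m adj f, fun u hu =>
      left_hom_ext m adj (hu.trans (leftCurry_ev m adj f).symm)⟩
  have hiff : ¬ IsZero m → ((actionRight C (RightMod.regular (R.obj m))).EssSurj ↔
      (actionRight C m).EssSurj) := fun hm => by
    have : R.Faithful := faithful_rightAdjoint_of_isSemisimpleCategory hD.semisimple adj
      fun W hW => hD.isZero_of_forall_hom_eq_zero hcontract' hexpand hm hW
    exact essSurj_free_iff_left (R.obj m) adj hD.semisimple huniv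
  constructor
  · rintro ⟨hE, hL⟩
    refine (hiff fun hm => hE ?_).1 hL
    rw [IsZero.iff_id_eq_zero]
    exact left_hom_ext m adj (hm.eq_of_tgt _ _)
  · intro hF
    -- If `m` were zero, contraction would make every `X ⊙ₗ m` zero, hence every object of `D`.
    have hm : ¬ IsZero m := fun hm => by
      obtain ⟨d, hd⟩ := hD.nonzero
      obtain ⟨X, ⟨e⟩⟩ := hF.mem_essImage d
      refine hd (IsZero.of_iso ?_ e.symm)
      rw [IsZero.iff_id_eq_zero]
      exact hcontract' X _ _ _ (hm.eq_of_tgt _ _)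
    refine ⟨fun hE => hm ?_, (hiff hm).2 hF⟩
    -- If `E` is zero, every morphism `X ⊙ₗ m ⟶ m` vanishes, in particular the unitor.
    have : (λₗ[C] m).hom = 0 := by
      rw [← leftCurry_ev m adj (λₗ[C] m).hom, ← leftCurry_ev m adj (0 : 𝟙_ C ⊙ₗ m ⟶ m),
        hE.eq_of_tgt (leftCurry m adj (λₗ[C] m).hom) (leftCurry m adj 0)]
    rw [IsZero.iff_id_eq_zero, ← cancel_epi (λₗ[C] m).hom, this, zero_comp, zero_comp]

end LeftDuality

/-! ### Right modules in a rigid abelian category -/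

section Adjoints

/-- A functor with a universal arrow to every object is a left adjoint. -/
theorem isLeftAdjoint_of_forall_exists_universal {C : Type u} [Category.{v} C] {D : Type u'}
    [Category.{v'} D] (F : C ⥤ D)
    (h : ∀ d : D, ∃ (X : C) (ε : F.obj X ⟶ d), ∀ (Y : C) (f : F.obj Y ⟶ d),
      ∃! u : Y ⟶ X, F.map u ≫ ε = f) : F.IsLeftAdjoint := by
  have : ∀ d : D, HasTerminal (CostructuredArrow F d) := fun d => by
    obtain ⟨X, ε, hX⟩ := h d
    choose u hu hu' using hX
    exact (IsTerminal.ofUniqueHom (Y := CostructuredArrow.mk ε)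
      (fun Z => CostructuredArrow.homMk (u _ Z.hom) (hu _ Z.hom))
      (fun Z g => CostructuredArrow.hom_ext _ _ (hu' _ _ _ (CostructuredArrow.w g)))).hasTerminal
  exact isLeftAdjoint_of_costructuredArrowTerminals F

theorem exists_universal_of_adjunction {C : Type u} [Category.{v} C] {D : Type u'}
    [Category.{v'} D] {F : C ⥤ D} {R : D ⥤ C} (adj : F ⊣ R) (d : D) :
    ∃ (X : C) (ε : F.obj X ⟶ d), ∀ (Y : C) (f : F.obj Y ⟶ d), ∃! u : Y ⟶ X, F.map u ≫ ε = f := by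
  refine ⟨R.obj d, adj.counit.app d, fun Y f => ⟨adj.homEquiv Y d f, ?_, fun u hu => ?_⟩⟩
  · exact (adj.homEquiv_counit (g := adj.homEquiv Y d f)).symm.trans
      ((adj.homEquiv Y d).symm_apply_apply f)
  · rw [← hu, ← adj.homEquiv_counit, Equiv.apply_symm_apply]

end Adjoints

namespace RightMod

open MonoidalLeftAction

variable {C : Type u} [Category.{v} C] [MonoidalCategory C] {A : C} [MonObj A]

/-- The kernel in `C` is stable under the action by linearity of `f`, and the module axioms can be
tested after the monomorphism into `M`. -/
instance [Preadditive C] [MonoidalPreadditive C] [HasKernels C] : HasKernels (RightMod A) where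
  has_limit {M N} f := by
    have hf : kernel.ι f.hom ≫ f.hom = 0 := kernel.condition _
    let a : kernel f.hom ⊗ A ⟶ kernel f.hom := kernel.lift f.hom (kernel.ι f.hom ▷ A ≫ M.act) (by
      rw [Category.assoc, f.act_hom, ← comp_whiskerRight_assoc, hf]
      simp)
    have ha : a ≫ kernel.ι f.hom = kernel.ι f.hom ▷ A ≫ M.act := kernel.lift_ι _ _ _
    let K : RightMod A :=
      { X := kernel f.hom
        act := a
        act_one := by
          rw [← cancel_mono (kernel.ι f.hom), Category.assoc, ha, whisker_exchange_assoc, M.act_one]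
          simp
        act_mul := by
          rw [← cancel_mono (kernel.ι f.hom)]
          simp only [Category.assoc, ha]
          rw [whisker_exchange_assoc, M.act_mul, ← comp_whiskerRight_assoc, ha]
          simp }
    let i : K ⟶ M := ⟨kernel.ι f.hom, ha⟩
    have : Mono i := ⟨fun g h e =>
      hom_ext _ _ ((cancel_mono (kernel.ι f.hom)).1 (congrArg Hom.hom e))⟩
    refine ⟨⟨KernelFork.ofι i (hom_ext _ _ hf), KernelFork.IsLimit.ofι' _ _ fun {Z} g hg => ?_⟩⟩
    have hg' : g.hom ≫ f.hom = 0 := congrArg Hom.hom hg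
    have hl : kernel.lift f.hom g.hom hg' ≫ kernel.ι f.hom = g.hom := kernel.lift_ι _ _ _
    refine ⟨⟨kernel.lift f.hom g.hom hg', ?_⟩, hom_ext _ _ hl⟩
    rw [← cancel_mono (kernel.ι f.hom), Category.assoc, hl, g.act_hom]
    change _ = (_ ≫ a) ≫ _
    rw [Category.assoc, ha, ← comp_whiskerRight_assoc, hl]

/-- The internal Hom over `A` is the equalizer of two morphisms from `H`, the internal Hom of
underlying objects from `M` to `d`, to `H'`, the one from `M ⊗ A` to `d`: act on `M` before
evaluating, or on `d` after. Both exist by rigidity. -/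
theorem isLeftAdjoint_actionRight [RigidCategory C] [HasEqualizers C] (M : RightMod A) :
    (actionRight C M).IsLeftAdjoint := by
  refine isLeftAdjoint_of_forall_exists_universal _ fun d => ?_
  obtain ⟨H, ev, hev⟩ := exists_universal_of_adjunction (tensorRightAdjunction M.X (M.Xᘁ : C)) d.X
  obtain ⟨H', ev', hev'⟩ :=
    exists_universal_of_adjunction (tensorRightAdjunction (M.X ⊗ A) ((M.X ⊗ A)ᘁ : C)) d.X
  change H ⊗ M.X ⟶ d.X at ev
  change H' ⊗ (M.X ⊗ A) ⟶ d.X at ev'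
  change ∀ (Y : C) (f : Y ⊗ M.X ⟶ d.X), ∃! u : Y ⟶ H, u ▷ M.X ≫ ev = f at hev
  change ∀ (Y : C) (f : Y ⊗ (M.X ⊗ A) ⟶ d.X), ∃! u : Y ⟶ H', u ▷ (M.X ⊗ A) ≫ ev' = f at hev'
  obtain ⟨a, ha, -⟩ := hev' H (H ◁ M.act ≫ ev)
  obtain ⟨b, hb, -⟩ := hev' H ((α_ H M.X A).inv ≫ ev ▷ A ≫ d.act)
  -- Equalizing `a` and `b` is linearity of the transposed morphism.
  have hlin : ∀ {Y : C} (u : Y ⟶ H), u ≫ a = u ≫ b ↔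
      ((α_ Y M.X A).hom ≫ Y ◁ M.act) ≫ u ▷ M.X ≫ ev = (u ▷ M.X ≫ ev) ▷ A ≫ d.act := by
    intro Y u
    have h₁ : ((α_ Y M.X A).hom ≫ Y ◁ M.act) ≫ u ▷ M.X ≫ ev =
        (α_ Y M.X A).hom ≫ (u ≫ a) ▷ (M.X ⊗ A) ≫ ev' := by
      rw [comp_whiskerRight, Category.assoc, Category.assoc, ha, whisker_exchange_assoc]
    have h₂ : (u ▷ M.X ≫ ev) ▷ A ≫ d.act =
        (α_ Y M.X A).hom ≫ (u ≫ b) ▷ (M.X ⊗ A) ≫ ev' := by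
      rw [comp_whiskerRight u b, Category.assoc, hb]
      simp
    rw [h₁, h₂, cancel_epi (α_ Y M.X A).hom]
    refine ⟨fun h => by rw [h], fun h => (hev' Y _).unique h rfl⟩
  let ε : tensor (equalizer a b) M ⟶ d :=
    ⟨equalizer.ι a b ▷ M.X ≫ ev, (hlin _).1 (equalizer.condition a b)⟩
  refine ⟨equalizer a b, ε, fun Y f => ?_⟩
  obtain ⟨φ, hφ⟩ : ∃ φ : Y ⊗ M.X ⟶ d.X, φ = Hom.hom f := ⟨_, rfl⟩
  obtain ⟨u, hu, hu'⟩ := hev Y φ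
  have hab : u ≫ a = u ≫ b := (hlin u).2 (by rw [hu, hφ]; exact f.act_hom)
  refine ⟨equalizer.lift u hab, hom_ext _ _ ?_, fun w hw => ?_⟩
  · change equalizer.lift u hab ▷ M.X ≫ equalizer.ι a b ▷ M.X ≫ ev = Hom.hom f
    rw [← comp_whiskerRight_assoc, equalizer.lift_ι, hu, hφ]
  · rw [← cancel_mono (equalizer.ι a b), equalizer.lift_ι]
    apply hu'
    have : w ▷ M.X ≫ equalizer.ι a b ▷ M.X ≫ ev = Hom.hom f := congrArg Hom.hom hw
    rw [comp_whiskerRight, Category.assoc, this, hφ]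

/-- On underlying objects, contraction is the duality bijection of `C`. -/
theorem leftContract_injective [RigidCategory C] (X : C) (Z d : RightMod A) :
    Function.Injective (leftContract : (Z ⟶ X ⊙ₗ d) → _) := fun f g h => by
  apply hom_ext
  apply (tensorLeftHomEquiv Z.X X (Xᘁ : C) d.X).symm.injective
  exact congrArg Hom.hom h

variable [Preadditive C] [MonoidalPreadditive C]

theorem eq_zero_of_leftContract_eq_zero [RigidCategory C] (X : C) (Z d : RightMod A)
    (f : Z ⟶ X ⊙ₗ d) (h : leftContract f = 0) : f = 0 := by
  apply leftContract_injective
  rw [h]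
  apply hom_ext
  change 0 = (Xᘁ : C) ◁ (0 : Z.X ⟶ X ⊗ d.X) ≫ (α_ (Xᘁ : C) X d.X).inv ≫ ε_ X (Xᘁ : C) ▷ d.X ≫ (λ_ d.X).hom
  simp

theorem eq_zero_of_leftExpand_eq_zero [RigidCategory C] (X : C) (Z d : RightMod A)
    (f : X ⊙ₗ Z ⟶ d) (h : leftExpand f = 0) : f = 0 := by
  apply hom_ext
  apply (tensorLeftHomEquiv Z.X (ᘁX : C) X d.X).injective
  refine (congrArg Hom.hom h).trans ?_
  change 0 = (λ_ Z.X).inv ≫ η_ (ᘁX : C) X ▷ Z.X ≫ (α_ (ᘁX : C) X Z.X).hom ≫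
    (ᘁX : C) ◁ (0 : X ⊗ Z.X ⟶ d.X)
  simp

instance (M : RightMod A) : (actionRight C M).Additive where
  map_add {_ _ f g} := hom_ext _ _ (MonoidalPreadditive.add_whiskerRight f g)

end RightMod

/-! ### Internal Homs in right module categories -/

section RightInternalHom

open MonoidalRightAction

variable {C : Type u} [Category.{v} C] [MonoidalCategory C]

/-! ### Free left modules and the bar presentation -/

namespace LeftMod

variable {E : C} [MonObj E]

theorem eq_of_tensor_regular_linear {X : C} (N : Mod C E) {f : E ⊗ X ⟶ N.X}
    (hf : ((α_ E E X).inv ≫ μ[E] ▷ X) ≫ f = E ◁ f ≫ γ[E, N.X]) :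
    f = E ◁ ((λ_ X).inv ≫ η[E] ▷ X ≫ f) ≫ γ[E, N.X] := by
  simp only [MonoidalCategory.whiskerLeft_comp, Category.assoc]
  rw [← hf]
  have h : E ◁ η[E] ▷ X ≫ (α_ E E X).inv ≫ μ[E] ▷ X = (α_ E (𝟙_ C) X).inv ≫ (ρ_ E).hom ▷ X := by
    rw [← MonObj.mul_one, comp_whiskerRight, associator_inv_naturality_middle_assoc]
  rw [Category.assoc, reassoc_of% h]
  simp

/-- A morphism out of a free left module is determined by its restriction to the generators. -/
theorem tensor_regular_hom_ext {X : C} {N : Mod C E} {f g : tensor (Mod.regular E) X ⟶ N}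
    (h : (λ_ X).inv ≫ η[E] ▷ X ≫ f.hom = (λ_ X).inv ≫ η[E] ▷ X ≫ g.hom) : f = g := by
  apply Mod.hom_ext
  refine (eq_of_tensor_regular_linear N f.isModHom.smul_hom).trans
    (Eq.trans ?_ (eq_of_tensor_regular_linear N g.isModHom.smul_hom).symm)
  exact congrArg (fun x => E ◁ x ≫ γ[E, N.X]) h

/-- Every left module is the cokernel of a morphism between free left modules. -/
theorem exists_free_presentation [Preadditive C] [MonoidalPreadditive C] (P : Mod C E) :
    ∃ (X Y : C) (g : tensor (Mod.regular E) Y ⟶ tensor (Mod.regular E) X)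
      (p : tensor (Mod.regular E) X ⟶ P) (_ : g ≫ p = 0) (_ : Epi p),
      ∀ k : tensor (Mod.regular E) X ⟶ tensor (Mod.regular E) X, g ≫ k = 0 →
        ∃ s, p ≫ s = k := by
  -- The bar presentation with `E` on the left: `g₁` acts on `P` and `g₂` multiplies in `E`.
  let p : tensor (Mod.regular E) P.X ⟶ P :=
    Mod.Hom.mk' (M := tensor (Mod.regular E) P.X) γ[E, P.X] (by
      change ((α_ E E P.X).inv ≫ μ[E] ▷ P.X) ≫ γ[E, P.X] = E ◁ γ[E, P.X] ≫ γ[E, P.X]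
      simp)
  let g₁ : tensor (Mod.regular E) (E ⊗ P.X) ⟶ tensor (Mod.regular E) P.X :=
    Mod.Hom.mk' (M := tensor (Mod.regular E) (E ⊗ P.X)) (N := tensor (Mod.regular E) P.X)
      (E ◁ γ[E, P.X]) (by
      change ((α_ E E (E ⊗ P.X)).inv ≫ μ[E] ▷ (E ⊗ P.X)) ≫ E ◁ γ[E, P.X] =
        E ◁ E ◁ γ[E, P.X] ≫ (α_ E E P.X).inv ≫ μ[E] ▷ P.X
      rw [Category.assoc, ← whisker_exchange]
      simp)
  let g₂ : tensor (Mod.regular E) (E ⊗ P.X) ⟶ tensor (Mod.regular E) P.X :=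
    Mod.Hom.mk' (M := tensor (Mod.regular E) (E ⊗ P.X)) (N := tensor (Mod.regular E) P.X)
      ((α_ E E P.X).inv ≫ μ[E] ▷ P.X) (by
      change ((α_ E E (E ⊗ P.X)).inv ≫ μ[E] ▷ (E ⊗ P.X)) ≫ (α_ E E P.X).inv ≫ μ[E] ▷ P.X =
        E ◁ ((α_ E E P.X).inv ≫ μ[E] ▷ P.X) ≫ (α_ E E P.X).inv ≫ μ[E] ▷ P.X
      have h := congrArg (fun x => (α_ E E E).inv ≫ x) (MonObj.mul_assoc E)
      simp only [Iso.inv_hom_id_assoc] at h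
      simp only [MonoidalCategory.whiskerLeft_comp, whisker_assoc_symm, Category.assoc,
        Iso.hom_inv_id_assoc, whiskerRight_tensor]
      rw [← comp_whiskerRight, ← comp_whiskerRight, ← h]
      simp only [comp_whiskerRight, pentagon_inv_assoc])
  have hu : (λ_ P.X).inv ≫ η[E] ▷ P.X ≫ γ[E, P.X] = 𝟙 P.X := by
    rw [ModObj.one_smul_self, Iso.inv_hom_id]
  refine ⟨P.X, E ⊗ P.X, g₁ - g₂, p, ?_, ⟨fun {Z} a b hab => ?_⟩, fun k hk => ?_⟩
  · rw [Preadditive.sub_comp, sub_eq_zero]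
    apply Mod.hom_ext
    change E ◁ γ[E, P.X] ≫ γ[E, P.X] = ((α_ E E P.X).inv ≫ μ[E] ▷ P.X) ≫ γ[E, P.X]
    simp
  · apply Mod.hom_ext
    have hab' : γ[E, P.X] ≫ a.hom = γ[E, P.X] ≫ b.hom := congrArg Mod.Hom.hom hab
    have := congrArg (fun x => (λ_ P.X).inv ≫ η[E] ▷ P.X ≫ x) hab'
    rwa [reassoc_of% hu, reassoc_of% hu] at this
  · rw [Preadditive.sub_comp, sub_eq_zero] at hk
    obtain ⟨f, hf⟩ : ∃ f : E ⊗ P.X ⟶ E ⊗ P.X, f = k.hom := ⟨_, rfl⟩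
    have hk' : E ◁ γ[E, P.X] ≫ f = ((α_ E E P.X).inv ≫ μ[E] ▷ P.X) ≫ f := by
      rw [hf]; exact congrArg Mod.Hom.hom hk
    have hpf : γ[E, P.X] ≫ (λ_ P.X).inv ≫ η[E] ▷ P.X ≫ f = f := by
      have := congrArg (fun x => (λ_ _).inv ≫ η[E] ▷ (E ⊗ P.X) ≫ x) hk'
      simp only [← whisker_exchange_assoc] at this
      simpa [← comp_whiskerRight_assoc] using this
    refine ⟨Mod.Hom.mk' (N := tensor (Mod.regular E) P.X) ((λ_ P.X).inv ≫ η[E] ▷ P.X ≫ f) ?_,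
      Mod.hom_ext _ _ (hpf.trans hf)⟩
    refine hpf.trans (eq_of_tensor_regular_linear (tensor (Mod.regular E) P.X) ?_)
    rw [hf]
    exact k.isModHom.smul_hom

end LeftMod

/-! ### The internal Hom as a functor to left modules -/

variable {D : Type u'} [Category.{v'} D] [MonoidalRightAction C D]

/-- A right action of an algebra `E` on an object of a right module category. -/
class RightModObj (E : C) [MonObj E] (n : D) where
  /-- The action. -/
  act : n ⊙ᵣ E ⟶ n
  act_one : n ⊴ᵣ η[E] ≫ act = (ρᵣ n).hom
  act_mul : n ⊴ᵣ μ[E] ≫ act = (αᵣ n E E).hom ≫ act ⊵ᵣ E ≫ act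

variable {n : D} {R : D ⥤ C} (adj : actionLeft C n ⊣ R)

/-- The evaluation `n ⊙ᵣ R d ⟶ d`. -/
def rightHomEv (d : D) : n ⊙ᵣ R.obj d ⟶ d := adj.counit.app d

/-- The morphism `X ⟶ R d` corresponding to `f : n ⊙ᵣ X ⟶ d`. -/
def rightHomCurry {X : C} {d : D} (f : n ⊙ᵣ X ⟶ d) : X ⟶ R.obj d := adj.homEquiv X d f

theorem rightHomCurry_ev {X : C} {d : D} (f : n ⊙ᵣ X ⟶ d) :
    n ⊴ᵣ rightHomCurry adj f ≫ rightHomEv adj d = f :=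
  (adj.homEquiv_counit (g := adj.homEquiv X d f)).symm.trans
    ((adj.homEquiv X d).symm_apply_apply f)

theorem rightHom_ext {X : C} {d : D} {f g : X ⟶ R.obj d}
    (h : n ⊴ᵣ f ≫ rightHomEv adj d = n ⊴ᵣ g ≫ rightHomEv adj d) : f = g := by
  apply (adj.homEquiv X d).symm.injective
  rw [adj.homEquiv_counit, adj.homEquiv_counit]
  exact h

theorem rightHom_map_ev {d d' : D} (f : d ⟶ d') :
    n ⊴ᵣ R.map f ≫ rightHomEv adj d' = rightHomEv adj d ≫ f :=
  adj.counit.naturality f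

variable (E : C) [MonObj E] [RightModObj E n]

/-- The left action of `E` on the internal Hom from `n` to `d`. -/
def rightHomAct (d : D) : E ⊗ R.obj d ⟶ R.obj d :=
  rightHomCurry adj
    ((αᵣ n E (R.obj d)).hom ≫ RightModObj.act (E := E) (n := n) ⊵ᵣ R.obj d ≫ rightHomEv adj d)

theorem rightHomAct_ev (d : D) :
    n ⊴ᵣ rightHomAct adj E d ≫ rightHomEv adj d =
      (αᵣ n E (R.obj d)).hom ≫ RightModObj.act (E := E) (n := n) ⊵ᵣ R.obj d ≫
        rightHomEv adj d :=
  rightHomCurry_ev adj _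

theorem one_rightHomAct (d : D) :
    η[E] ▷ R.obj d ≫ rightHomAct adj E d = (λ_ (R.obj d)).hom := by
  apply rightHom_ext adj
  rw [actionHomRight_comp, Category.assoc, rightHomAct_ev, actionHomRight_whiskerRight]
  simp only [Category.assoc, Iso.inv_hom_id_assoc]
  rw [← comp_actionHomLeft_assoc, RightModObj.act_one]
  simp

theorem mul_rightHomAct (d : D) :
    μ[E] ▷ R.obj d ≫ rightHomAct adj E d =
      (α_ E E (R.obj d)).hom ≫ E ◁ rightHomAct adj E d ≫ rightHomAct adj E d := by
  apply rightHom_ext adj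
  simp only [actionHomRight_comp, Category.assoc, rightHomAct_ev]
  rw [actionHomRight_whiskerRight, whiskerRight_actionHomLeft]
  simp only [Category.assoc, Iso.inv_hom_id_assoc]
  rw [action_exchange_assoc, rightHomAct_ev, ← comp_actionHomLeft_assoc, RightModObj.act_mul]
  simp only [comp_actionHomLeft, Category.assoc, actionHomLeft_tensor, Iso.inv_hom_id_assoc]
  rw [actionHom_associator_assoc]

theorem rightHomAct_map {d d' : D} (f : d ⟶ d') :
    rightHomAct adj E d ≫ R.map f = E ◁ R.map f ≫ rightHomAct adj E d' := by
  apply rightHom_ext adj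
  simp only [actionHomRight_comp, Category.assoc, rightHomAct_ev, rightHom_map_ev]
  rw [reassoc_of% (rightHomAct_ev adj E), whiskerRight_actionHomLeft]
  simp only [Category.assoc, Iso.inv_hom_id_assoc]
  rw [action_exchange_assoc, rightHom_map_ev]

/-- The internal Hom from `n` to `d` as a left `E`-module. -/
def rightHomModuleObj (d : D) : Mod C E where
  X := R.obj d
  mod :=
    { smul := rightHomAct adj E d
      one_smul := one_rightHomAct adj E d
      mul_smul := mul_rightHomAct adj E d }

/-- If `E` acts on `n`, then the internal Hom out of `n` takes values in left `E`-modules. -/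
def rightHomModule : D ⥤ Mod C E where
  obj d := rightHomModuleObj adj E d
  map {d d'} f := Mod.Hom.mk' (M := rightHomModuleObj adj E d) (N := rightHomModuleObj adj E d')
    (R.map f) (rightHomAct_map adj E f)
  map_id d := Mod.hom_ext _ _ (R.map_id d)
  map_comp f g := Mod.hom_ext _ _ (R.map_comp f g)

/-- The canonical morphism from `E ⊗ X` to the internal Hom from `n` to `n ⊙ᵣ X`. -/
def toRightHom (X : C) : E ⊗ X ⟶ R.obj (n ⊙ᵣ X) :=
  rightHomCurry adj ((αᵣ n E X).hom ≫ RightModObj.act ⊵ᵣ X)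

theorem toRightHom_linear (X : C) :
    ((α_ E E X).inv ≫ μ[E] ▷ X) ≫ toRightHom adj E X =
      E ◁ toRightHom adj E X ≫ rightHomAct adj E (n ⊙ᵣ X) := by
  rw [Category.assoc, Iso.inv_comp_eq]
  apply rightHom_ext adj
  dsimp only [toRightHom]
  simp only [actionHomRight_comp, Category.assoc, rightHomCurry_ev, rightHomAct_ev]
  rw [actionHomRight_whiskerRight, whiskerRight_actionHomLeft]
  simp only [Category.assoc, Iso.inv_hom_id_assoc]
  rw [action_exchange_assoc, rightHomCurry_ev, ← comp_actionHomLeft, RightModObj.act_mul]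
  simp only [comp_actionHomLeft, actionHomLeft_tensor, Category.assoc, Iso.inv_hom_id_assoc]
  rw [actionHom_associator_assoc]

/-- As on the other side, the generators of the free module go to the unit of the adjunction. -/
theorem unit_toRightHom (X : C) :
    (λ_ X).inv ≫ η[E] ▷ X ≫ toRightHom adj E X = rightHomCurry adj (𝟙 (n ⊙ᵣ X)) := by
  apply rightHom_ext adj
  simp only [actionHomRight_comp, Category.assoc, rightHomCurry_ev, toRightHom]
  rw [actionHomRight_whiskerRight]
  simp only [Category.assoc, Iso.inv_hom_id_assoc]
  rw [← comp_actionHomLeft, RightModObj.act_one, ← actionHom_leftUnitor, actionHomRight_inv_hom]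

/-- If `n ⊙ᵣ (E ⊗ X) ⟶ n ⊙ᵣ X` is universal, then the internal Hom from `n` to `n ⊙ᵣ X` is the
free left `E`-module on `X`. -/
theorem exists_iso_rightHomModule (X : C)
    (huniv : ∀ (Y : C) (f : n ⊙ᵣ Y ⟶ n ⊙ᵣ X),
      ∃! u : Y ⟶ E ⊗ X, n ⊴ᵣ u ≫ (αᵣ n E X).hom ≫ RightModObj.act ⊵ᵣ X = f) :
    ∃ θ : LeftMod.tensor (Mod.regular E) X ≅ (rightHomModule adj E).obj (n ⊙ᵣ X),
      θ.hom.hom = toRightHom adj E X := by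
  obtain ⟨u, hu, -⟩ := huniv (R.obj (n ⊙ᵣ X)) (rightHomEv adj _)
  have h₁ : u ≫ toRightHom adj E X = 𝟙 _ := by
    apply rightHom_ext adj
    rw [actionHomRight_comp, Category.assoc, toRightHom, rightHomCurry_ev, hu, actionHomRight_id,
      Category.id_comp]
  have h₂ : toRightHom adj E X ≫ u = 𝟙 _ := by
    apply (huniv (E ⊗ X) ((αᵣ n E X).hom ≫ RightModObj.act ⊵ᵣ X)).unique
    · rw [actionHomRight_comp, Category.assoc, hu, toRightHom, rightHomCurry_ev]
    · rw [actionHomRight_id, Category.id_comp]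
  have hl := toRightHom_linear adj E X
  have hl' : rightHomAct adj E (n ⊙ᵣ X) ≫ u = E ◁ u ≫ (α_ E E X).inv ≫ μ[E] ▷ X := by
    have := congrArg (fun x => E ◁ u ≫ x ≫ u) hl
    simp only [Category.assoc, h₂, Category.comp_id] at this
    rw [← MonoidalCategory.whiskerLeft_comp_assoc, h₁, MonoidalCategory.whiskerLeft_id,
      Category.id_comp] at this
    exact this.symm
  exact ⟨⟨Mod.Hom.mk' (M := LeftMod.tensor (Mod.regular E) X)
      (N := (rightHomModule adj E).obj (n ⊙ᵣ X)) (toRightHom adj E X) hl,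
    Mod.Hom.mk' (N := LeftMod.tensor (Mod.regular E) X)
      (M := (rightHomModule adj E).obj (n ⊙ᵣ X)) u hl',
    Mod.hom_ext _ _ h₂, Mod.hom_ext _ _ h₁⟩, rfl⟩

theorem exists_rightHomModule_map_eq {X : C} {d : D}
    (θ : LeftMod.tensor (Mod.regular E) X ≅ (rightHomModule adj E).obj (n ⊙ᵣ X))
    (hθ : θ.hom.hom = toRightHom adj E X)
    (φ : (rightHomModule adj E).obj (n ⊙ᵣ X) ⟶ (rightHomModule adj E).obj d) :
    ∃ f : n ⊙ᵣ X ⟶ d, (rightHomModule adj E).map f = φ := by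
  obtain ⟨ψ, hψ⟩ : ∃ ψ : R.obj (n ⊙ᵣ X) ⟶ R.obj d, ψ = φ.hom := ⟨_, rfl⟩
  refine ⟨n ⊴ᵣ (rightHomCurry adj (𝟙 (n ⊙ᵣ X)) ≫ ψ) ≫ rightHomEv adj d, ?_⟩
  rw [← cancel_epi θ.hom]
  apply LeftMod.tensor_regular_hom_ext
  simp only [Mod.comp_hom', hθ, ← hψ]
  change (λ_ X).inv ≫ η[E] ▷ X ≫ toRightHom adj E X ≫ R.map _ =
    (λ_ X).inv ≫ η[E] ▷ X ≫ toRightHom adj E X ≫ ψ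
  have hx := unit_toRightHom adj E X
  have hx' := congrArg (· ≫ ψ) hx
  have hx'' := congrArg
    (· ≫ R.map (n ⊴ᵣ (rightHomCurry adj (𝟙 (n ⊙ᵣ X)) ≫ ψ) ≫ rightHomEv adj d)) hx
  simp only [Category.assoc] at hx' hx''
  rw [hx', hx'']
  apply rightHom_ext adj
  rw [actionHomRight_comp, Category.assoc, rightHom_map_ev, reassoc_of% (rightHomCurry_ev adj),
    Category.id_comp]

/-- Let `E` act on `n` so that `n ⊙ᵣ (E ⊗ X) ⟶ n ⊙ᵣ X` is universal among the morphisms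
`n ⊙ᵣ Y ⟶ n ⊙ᵣ X`. If the internal Hom out of `n` is faithful, then the free left `E`-module
functor is essentially surjective if and only if `(n ⊙ᵣ -)` is. -/
theorem essSurj_free_iff_right (adj : actionLeft C n ⊣ R) [Preadditive C] [MonoidalPreadditive C]
    [Preadditive D] [HasKernels D] (hD : IsSemisimpleCategory D) [(actionLeft C n).Additive]
    [R.Faithful]
    (huniv : ∀ (X Y : C) (f : n ⊙ᵣ Y ⟶ n ⊙ᵣ X),
      ∃! u : Y ⟶ E ⊗ X, n ⊴ᵣ u ≫ (αᵣ n E X).hom ≫ RightModObj.act ⊵ᵣ X = f) :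
    (actionLeft C (Mod.regular E)).EssSurj ↔ (actionLeft C n).EssSurj := by
  have hR : R.Additive := adj.right_adjoint_additive
  have : (rightHomModule adj E).Faithful :=
    ⟨fun h => R.map_injective (congrArg Mod.Hom.hom h)⟩
  have : (rightHomModule adj E).Additive := ⟨Mod.hom_ext _ _ R.map_add⟩
  choose θ hθ using fun X => exists_iso_rightHomModule adj E X (huniv X)
  exact essSurj_iff_of_isSemisimpleCategory (G := rightHomModule adj E) hD θ
    (fun X d φ => exists_rightHomModule_map_eq adj E (θ X) (hθ X) φ)
    LeftMod.exists_free_presentation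

end RightInternalHom

/-! ### Right module categories over a rigid category -/

section RightDuality

open MonoidalRightAction

variable {C : Type u} [Category.{v} C] [MonoidalCategory C] [RigidCategory C]
  {D : Type u'} [Category.{v'} D] [MonoidalRightAction C D]

/-- The morphism `Z ⊙ᵣ ᘁX ⟶ d` corresponding to `f : Z ⟶ d ⊙ᵣ X`. -/
def rightContract {X : C} {Z d : D} (f : Z ⟶ d ⊙ᵣ X) : Z ⊙ᵣ (ᘁX : C) ⟶ d :=
  f ⊵ᵣ (ᘁX : C) ≫ (αᵣ d X (ᘁX : C)).inv ≫ d ⊴ᵣ ε_ (ᘁX : C) X ≫ (ρᵣ d).hom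

/-- The morphism `Z ⟶ d ⊙ᵣ Xᘁ` corresponding to `f : Z ⊙ᵣ X ⟶ d`. -/
def rightExpand {X : C} {Z d : D} (f : Z ⊙ᵣ X ⟶ d) : Z ⟶ d ⊙ᵣ (Xᘁ : C) :=
  (ρᵣ Z).inv ≫ Z ⊴ᵣ η_ X (Xᘁ : C) ≫ (αᵣ Z X (Xᘁ : C)).hom ≫ f ⊵ᵣ (Xᘁ : C)

/-- Here the left dual `ᘁX` carries `X` across, again turning `u` into its mate. -/
theorem rightContract_action {X Y E : C} {n d : D} (u : Y ⟶ E ⊗ X) (g : n ⊙ᵣ E ⟶ d) :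
    rightContract (n ⊴ᵣ u ≫ (αᵣ n E X).hom ≫ g ⊵ᵣ X) =
      (αᵣ n Y (ᘁX : C)).inv ≫ n ⊴ᵣ (tensorRightHomEquiv Y (ᘁX : C) X E).symm u ≫ g := by
  have h : (tensorRightHomEquiv Y (ᘁX : C) X E).symm u =
    u ▷ (ᘁX : C) ≫ (α_ E X (ᘁX : C)).hom ≫ E ◁ ε_ (ᘁX : C) X ≫ (ρ_ E).hom := rfl
  rw [h, rightContract]
  simp only [comp_actionHomLeft, actionHomRight_comp, Category.assoc, actionHom_rightUnitor]
  rw [actionHomRight_whiskerRight, whiskerRight_actionHomLeft]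
  simp only [Category.assoc, Iso.inv_hom_id_assoc]
  rw [actionUnitIso_hom_naturality, action_exchange_assoc, actionHomLeft_tensor]
  simp only [Category.assoc]
  have hα : (αᵣ n (E ⊗ X) (ᘁX : C)).inv ≫ n ⊴ᵣ (α_ E X (ᘁX : C)).hom ≫
      (αᵣ n E (X ⊗ (ᘁX : C))).hom =
      (αᵣ n E X).hom ⊵ᵣ (ᘁX : C) ≫ (αᵣ (n ⊙ᵣ E) X (ᘁX : C)).inv := by
    rw [Iso.inv_comp_eq, ← Category.assoc ((αᵣ _ _ _).hom), Iso.eq_comp_inv]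
    have := actionHom_associator E X (ᘁX : C) n
    rw [Category.assoc, this]
  rw [reassoc_of% hα, Iso.inv_hom_id_assoc]

/-- If the algebra `E` acts on `n` by a universal morphism `n ⊙ᵣ E ⟶ n`, then
`n ⊙ᵣ (E ⊗ X) ⟶ n ⊙ᵣ X` is universal for every `X`. -/
theorem existsUnique_action_of_rightContract_injective
    (hinj : ∀ (X : C) (Z d : D), Function.Injective (rightContract : (Z ⟶ d ⊙ᵣ X) → _))
    {E : C} {n : D} (g : n ⊙ᵣ E ⟶ n)
    (hg : ∀ (Y : C) (f : n ⊙ᵣ Y ⟶ n), ∃! u : Y ⟶ E, n ⊴ᵣ u ≫ g = f)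
    (X Y : C) (f : n ⊙ᵣ Y ⟶ n ⊙ᵣ X) :
    ∃! u : Y ⟶ E ⊗ X, n ⊴ᵣ u ≫ (αᵣ n E X).hom ≫ g ⊵ᵣ X = f := by
  have key : ∀ u : Y ⟶ E ⊗ X, n ⊴ᵣ u ≫ (αᵣ n E X).hom ≫ g ⊵ᵣ X = f ↔
      n ⊴ᵣ (tensorRightHomEquiv Y (ᘁX : C) X E).symm u ≫ g =
        (αᵣ n Y (ᘁX : C)).hom ≫ rightContract f := by
    intro u
    rw [← (hinj X _ _).eq_iff, rightContract_action, Iso.inv_comp_eq]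
  obtain ⟨w, hw, hw'⟩ := hg _ ((αᵣ n Y (ᘁX : C)).hom ≫ rightContract f)
  refine ⟨tensorRightHomEquiv Y (ᘁX : C) X E w, (key _).2 (by simpa using hw), fun u hu => ?_⟩
  rw [← hw' _ ((key u).1 hu), Equiv.apply_symm_apply]

variable [Preadditive D]

/-- In an indecomposable semisimple module category, a non-zero object generates. -/
theorem RightOstrikHypothesis.isZero_of_forall_hom_eq_zero [HasKernels D]
    (hD : RightOstrikHypothesis C D)
    (hcontract : ∀ (X : C) (Z d : D) (f : Z ⟶ d ⊙ᵣ X), rightContract f = 0 → f = 0)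
    (hexpand : ∀ (X : C) (Z d : D) (f : Z ⊙ᵣ X ⟶ d), rightExpand f = 0 → f = 0)
    {n : D} (hn : ¬ IsZero n) {W : D} (hW : ∀ (X : C) (f : n ⊙ᵣ X ⟶ W), f = 0) : IsZero W := by
  let G : ObjectProperty D := fun Y => ∃ X : C, Y = n ⊙ᵣ X
  let Q : ObjectProperty D := fun W => ∀ Y, G Y → ∀ f : Y ⟶ W, f = 0
  let P : ObjectProperty D := fun Z => ∀ W, Q W → ∀ f : Z ⟶ W, f = 0
  have hQ : Q W := by rintro _ ⟨X, rfl⟩ f; exact hW X f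
  have hPn : P n := fun W hW f => by
    rw [← cancel_epi (ρᵣ[C] n).hom, comp_zero]
    exact hW _ ⟨_, rfl⟩ _
  have hPiso : P.IsClosedUnderIsomorphisms := ⟨fun e h W hW f => by
    rw [← cancel_epi e.hom, comp_zero]; exact h W hW _⟩
  have hQiso : Q.IsClosedUnderIsomorphisms := ⟨fun e h Y hY f => by
    rw [← cancel_mono e.inv, zero_comp]; exact h Y hY _⟩
  -- The duals exchange roles: `ᘁc` moves `c` to the source for `Q`, and `cᘁ` moves it to the target
  -- for `P`.
  have hQact : ∀ (X : D) (c : C), Q X → Q (X ⊙ᵣ c) := by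
    rintro X c hX _ ⟨Y, rfl⟩ f
    apply hcontract
    rw [← cancel_epi (αᵣ n Y (ᘁc : C)).hom, comp_zero]
    exact hX _ ⟨_, rfl⟩ _
  have hPact : ∀ (X : D) (c : C), P X → P (X ⊙ᵣ c) := fun X c hX W hW f =>
    hexpand _ _ _ _ (hX _ (hQact _ _ hW) _)
  rcases hD.indecomposable P Q hPiso hQiso hPact hQact
    (hD.semisimple.isInternalDirectSum_orthogonal G) with h | h
  · exact absurd (h n hPn) hn
  · exact h W hQ

/-- The internal End of an object `n` of an indecomposable semisimple right module category is a
left essential division algebra if and only if `(n ⊙ᵣ -)` is essentially surjective. -/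
theorem RightOstrikHypothesis.isLeftEssentialDivisionAlgebra_iff [Preadditive C]
    [MonoidalPreadditive C] [HasKernels D]
    (hD : RightOstrikHypothesis C D)
    (hcontract : ∀ (X : C) (Z d : D), Function.Injective (rightContract : (Z ⟶ d ⊙ᵣ X) → _))
    (hcontract' : ∀ (X : C) (Z d : D) (f : Z ⟶ d ⊙ᵣ X), rightContract f = 0 → f = 0)
    (hexpand : ∀ (X : C) (Z d : D) (f : Z ⊙ᵣ X ⟶ d), rightExpand f = 0 → f = 0)
    (n : D) [(actionLeft C n).Additive] {R : D ⥤ C} (adj : actionLeft C n ⊣ R) :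
    @IsLeftEssentialDivisionAlgebra C _ _ (R.obj n) (rightInternalEnd n adj) ↔
      (actionLeft C n).EssSurj := by
  let : MonObj (R.obj n) := rightInternalEnd n adj
  let : RightModObj (R.obj n) n :=
    { act := rightEv n adj
      act_one := rightCurry_ev n adj _
      act_mul := rightCurry_ev n adj _ }
  have huniv := existsUnique_action_of_rightContract_injective hcontract (rightEv n adj)
    fun Y f => ⟨rightCurry n adj f, rightCurry_ev n adj f, fun u hu =>
      right_hom_ext n adj (hu.trans (rightCurry_ev n adj f).symm)⟩
  have hiff : ¬ IsZero n → ((actionLeft C (Mod.regular (R.obj n))).EssSurj ↔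
      (actionLeft C n).EssSurj) := fun hn => by
    have : R.Faithful := faithful_rightAdjoint_of_isSemisimpleCategory hD.semisimple adj
      fun W hW => hD.isZero_of_forall_hom_eq_zero hcontract' hexpand hn hW
    exact essSurj_free_iff_right (R.obj n) adj hD.semisimple huniv
  constructor
  · rintro ⟨hE, hL⟩
    refine (hiff fun hn => hE ?_).1 hL
    rw [IsZero.iff_id_eq_zero]
    exact right_hom_ext n adj (hn.eq_of_tgt _ _)
  · intro hF
    have hn : ¬ IsZero n := fun hn => by
      obtain ⟨d, hd⟩ := hD.nonzero
      obtain ⟨X, ⟨e⟩⟩ := hF.mem_essImage d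
      refine hd (IsZero.of_iso ?_ e.symm)
      rw [IsZero.iff_id_eq_zero]
      exact hcontract' X _ _ _ (hn.eq_of_tgt _ _)
    refine ⟨fun hE => hn ?_, (hiff hn).2 hF⟩
    have : (ρᵣ[C] n).hom = 0 := by
      rw [← rightCurry_ev n adj (ρᵣ[C] n).hom, ← rightCurry_ev n adj (0 : n ⊙ᵣ 𝟙_ C ⟶ n),
        hE.eq_of_tgt (rightCurry n adj (ρᵣ[C] n).hom) (rightCurry n adj 0)]
    rw [IsZero.iff_id_eq_zero, ← cancel_epi (ρᵣ[C] n).hom, this, zero_comp, zero_comp]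

end RightDuality

/-! ### Left modules in a rigid abelian category -/

namespace LeftMod

open MonoidalRightAction

variable {C : Type u} [Category.{v} C] [MonoidalCategory C] {A : C} [MonObj A]

theorem smul_comp_hom {M N : Mod C A} (f : M ⟶ N) :
    γ[A, M.X] ≫ f.hom = A ◁ f.hom ≫ γ[A, N.X] :=
  f.isModHom.smul_hom

instance [Preadditive C] [MonoidalPreadditive C] [HasKernels C] : HasKernels (Mod C A) where
  has_limit {M N} f := by
    have hf : kernel.ι f.hom ≫ f.hom = 0 := kernel.condition _
    let a : A ⊗ kernel f.hom ⟶ kernel f.hom :=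
      kernel.lift f.hom (A ◁ kernel.ι f.hom ≫ γ[A, M.X]) (by
        rw [Category.assoc, smul_comp_hom, ← MonoidalCategory.whiskerLeft_comp_assoc, hf]
        simp)
    have ha : a ≫ kernel.ι f.hom = A ◁ kernel.ι f.hom ≫ γ[A, M.X] := kernel.lift_ι _ _ _
    let K : Mod C A :=
      { X := kernel f.hom
        mod :=
          { smul := a
            one_smul := by
              change η[A] ▷ kernel f.hom ≫ a = (λ_ (kernel f.hom)).hom
              rw [← cancel_mono (kernel.ι f.hom), Category.assoc, ha, ← whisker_exchange_assoc,
                ModObj.one_smul_self]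
              simp
            mul_smul := by
              change μ[A] ▷ kernel f.hom ≫ a = (α_ A A (kernel f.hom)).hom ≫ A ◁ a ≫ a
              rw [← cancel_mono (kernel.ι f.hom)]
              simp only [Category.assoc, ha]
              rw [← whisker_exchange_assoc, ModObj.mul_smul_self,
                ← MonoidalCategory.whiskerLeft_comp_assoc, ha]
              simp } }
    let i : K ⟶ M := Mod.Hom.mk' (M := K) (kernel.ι f.hom) ha
    have : Mono i := ⟨fun g h e =>
      Mod.hom_ext _ _ ((cancel_mono (kernel.ι f.hom)).1 (congrArg Mod.Hom.hom e))⟩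
    refine ⟨⟨KernelFork.ofι i (Mod.hom_ext _ _ hf), KernelFork.IsLimit.ofι' _ _ fun {Z} g hg => ?_⟩⟩
    have hg' : g.hom ≫ f.hom = 0 := congrArg Mod.Hom.hom hg
    have hl : kernel.lift f.hom g.hom hg' ≫ kernel.ι f.hom = g.hom := kernel.lift_ι _ _ _
    refine ⟨Mod.Hom.mk' (N := K) (kernel.lift f.hom g.hom hg') ?_, Mod.hom_ext _ _ hl⟩
    change γ[A, Z.X] ≫ kernel.lift f.hom g.hom hg' = A ◁ kernel.lift f.hom g.hom hg' ≫ a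
    rw [← cancel_mono (kernel.ι f.hom), Category.assoc, hl, smul_comp_hom, Category.assoc, ha,
      ← MonoidalCategory.whiskerLeft_comp_assoc, hl]

/-- Again an equalizer imposes linearity on the internal Hom of underlying objects, now built from
left duals. -/
theorem isLeftAdjoint_actionLeft [RigidCategory C] [HasEqualizers C] (N : Mod C A) :
    (actionLeft C N).IsLeftAdjoint := by
  refine isLeftAdjoint_of_forall_exists_universal _ fun d => ?_
  obtain ⟨H, ev, hev⟩ := exists_universal_of_adjunction (tensorLeftAdjunction (ᘁN.X : C) N.X) d.X
  obtain ⟨H', ev', hev'⟩ :=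
    exists_universal_of_adjunction (tensorLeftAdjunction (ᘁ(A ⊗ N.X) : C) (A ⊗ N.X)) d.X
  change N.X ⊗ H ⟶ d.X at ev
  change (A ⊗ N.X) ⊗ H' ⟶ d.X at ev'
  change ∀ (Y : C) (f : N.X ⊗ Y ⟶ d.X), ∃! u : Y ⟶ H, N.X ◁ u ≫ ev = f at hev
  change ∀ (Y : C) (f : (A ⊗ N.X) ⊗ Y ⟶ d.X), ∃! u : Y ⟶ H', (A ⊗ N.X) ◁ u ≫ ev' = f at hev'
  obtain ⟨a, ha, -⟩ := hev' H (γ[A, N.X] ▷ H ≫ ev)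
  obtain ⟨b, hb, -⟩ := hev' H ((α_ A N.X H).hom ≫ A ◁ ev ≫ γ[A, d.X])
  have hlin : ∀ {Y : C} (u : Y ⟶ H), u ≫ a = u ≫ b ↔
      ((α_ A N.X Y).inv ≫ γ[A, N.X] ▷ Y) ≫ N.X ◁ u ≫ ev = A ◁ (N.X ◁ u ≫ ev) ≫ γ[A, d.X] := by
    intro Y u
    have h₁ : ((α_ A N.X Y).inv ≫ γ[A, N.X] ▷ Y) ≫ N.X ◁ u ≫ ev =
        (α_ A N.X Y).inv ≫ (A ⊗ N.X) ◁ (u ≫ a) ≫ ev' := by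
      rw [MonoidalCategory.whiskerLeft_comp, Category.assoc, Category.assoc, ha,
        ← whisker_exchange_assoc]
      rfl
    have h₂ : A ◁ (N.X ◁ u ≫ ev) ≫ γ[A, d.X] =
        (α_ A N.X Y).inv ≫ (A ⊗ N.X) ◁ (u ≫ b) ≫ ev' := by
      rw [MonoidalCategory.whiskerLeft_comp _ u b, Category.assoc, hb]
      simp
    rw [h₁, h₂, cancel_epi (α_ A N.X Y).inv]
    refine ⟨fun h => by rw [h], fun h => (hev' Y _).unique h rfl⟩
  let ε : tensor N (equalizer a b) ⟶ d :=
    Mod.Hom.mk' (M := tensor N (equalizer a b)) (N.X ◁ equalizer.ι a b ≫ ev)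
      ((hlin _).1 (equalizer.condition a b))
  refine ⟨equalizer a b, ε, fun Y f => ?_⟩
  obtain ⟨φ, hφ⟩ : ∃ φ : N.X ⊗ Y ⟶ d.X, φ = f.hom := ⟨_, rfl⟩
  obtain ⟨u, hu, hu'⟩ := hev Y φ
  have hab : u ≫ a = u ≫ b := (hlin u).2 (by rw [hu, hφ]; exact f.isModHom.smul_hom)
  refine ⟨equalizer.lift u hab, Mod.hom_ext _ _ ?_, fun w hw => ?_⟩
  · change N.X ◁ equalizer.lift u hab ≫ N.X ◁ equalizer.ι a b ≫ ev = f.hom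
    rw [← MonoidalCategory.whiskerLeft_comp_assoc, equalizer.lift_ι, hu, hφ]
  · rw [← cancel_mono (equalizer.ι a b), equalizer.lift_ι]
    apply hu'
    have : N.X ◁ w ≫ N.X ◁ equalizer.ι a b ≫ ev = f.hom := congrArg Mod.Hom.hom hw
    rw [MonoidalCategory.whiskerLeft_comp, Category.assoc, this, hφ]

theorem rightContract_injective [RigidCategory C] (X : C) (Z d : Mod C A) :
    Function.Injective (rightContract : (Z ⟶ d ⊙ᵣ X) → _) := fun f g h => by
  apply Mod.hom_ext
  apply (tensorRightHomEquiv Z.X (ᘁX : C) X d.X).symm.injective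
  exact congrArg Mod.Hom.hom h

variable [Preadditive C] [MonoidalPreadditive C]

theorem eq_zero_of_rightContract_eq_zero [RigidCategory C] (X : C) (Z d : Mod C A)
    (f : Z ⟶ d ⊙ᵣ X) (h : rightContract f = 0) : f = 0 := by
  apply rightContract_injective
  rw [h]
  apply Mod.hom_ext
  change 0 = (0 : Z.X ⟶ d.X ⊗ X) ▷ (ᘁX : C) ≫ (α_ d.X X (ᘁX : C)).hom ≫
    d.X ◁ ε_ (ᘁX : C) X ≫ (ρ_ d.X).hom
  simp

theorem eq_zero_of_rightExpand_eq_zero [RigidCategory C] (X : C) (Z d : Mod C A)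
    (f : Z ⊙ᵣ X ⟶ d) (h : rightExpand f = 0) : f = 0 := by
  apply Mod.hom_ext
  apply (tensorRightHomEquiv Z.X X (Xᘁ : C) d.X).injective
  refine (congrArg Mod.Hom.hom h).trans ?_
  change 0 = (ρ_ Z.X).inv ≫ Z.X ◁ η_ X (Xᘁ : C) ≫ (α_ Z.X X (Xᘁ : C)).inv ≫
    (0 : Z.X ⊗ X ⟶ d.X) ▷ (Xᘁ : C)
  simp

instance (N : Mod C A) : (actionLeft C N).Additive where
  map_add {_ _ f g} := Mod.hom_ext _ _ (MonoidalPreadditive.whiskerLeft_add f g)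

end LeftMod

/-- The criteria for abstract module categories apply to `RightMod A` and `Mod C A`, where the
conditions on contraction and expansion are the duality bijections of `C`. The equivalences hold for
every choice of right adjoint. -/
theorem mainTheorem4 {k : Type w} [Field k] [IsAlgClosed k] [CharZero k]
    {C : Type u} [Category.{v} C] [Abelian C] [Linear k C] [MonoidalCategory C]
    [MonoidalPreadditive C] [MonoidalLinear k C] [RigidCategory C]
    (hC : IsMultifusion k C) (A : C) [MonObj A]
    (hright : LeftOstrikHypothesis C (RightMod A))
    (hleft : RightOstrikHypothesis C (Mod C A)) :
    (∀ M : RightMod A,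
      (MonoidalLeftAction.actionRight C M).IsLeftAdjoint ∧
      ∀ (R : RightMod A ⥤ C) (adj : MonoidalLeftAction.actionRight C M ⊣ R),
        @IsRightEssentialDivisionAlgebra C _ _ (R.obj M) (leftInternalEnd M adj) ↔
          (MonoidalLeftAction.actionRight C M).EssSurj) ∧
    (∀ N : Mod C A,
      (MonoidalRightAction.actionLeft C N).IsLeftAdjoint ∧
      ∀ (R : Mod C A ⥤ C) (adj : MonoidalRightAction.actionLeft C N ⊣ R),
        @IsLeftEssentialDivisionAlgebra C _ _ (R.obj N) (rightInternalEnd N adj) ↔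
          (MonoidalRightAction.actionLeft C N).EssSurj) := by
  refine ⟨fun M => ⟨RightMod.isLeftAdjoint_actionRight M, fun R adj => ?_⟩,
    fun N => ⟨LeftMod.isLeftAdjoint_actionLeft N, fun R adj => ?_⟩⟩
  · exact hright.isRightEssentialDivisionAlgebra_iff RightMod.leftContract_injective
      RightMod.eq_zero_of_leftContract_eq_zero RightMod.eq_zero_of_leftExpand_eq_zero M adj
  · exact hleft.isLeftEssentialDivisionAlgebra_iff LeftMod.rightContract_injective
      LeftMod.eq_zero_of_rightContract_eq_zero LeftMod.eq_zero_of_rightExpand_eq_zero N adj
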